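/- Let $k\ge 2$ and $1\le a\le n-k$. Consider complex $k\times n$ matrices $V=(v_1,\dots,v_n)$ of rank $k$ modulo left multiplication by $SL_k(\mathbb C)$ (points of the affine cone over $\mathrm{Gr}(k,n)$), with columns extended by $v_{j+n}=v_j$, and write $\Delta_J(V)=v_{j_1}\wedge\cdots\wedge v_{j_k}$ for the minors. Put $I(b,i)=\{b,\dots,b+i-1,\,n-k+i+1,\dots,n\}$ (an ordered set). * $\Pi^{\circ}_{k,n}$ is the locus where all cyclically consecutive minors $\Delta_{b,b+1,\dots,b+k-1}$, $1\le b\le n$, are nonzero. $\Pi^{\circ,1}_{k,n}\subset\Pi^{\circ}_{k,n}$ is the locus where moreover $\Delta_{b,\dots,b+k-1}=\Delta_{I(b,k)}=1$ for $1\le b\le n-k+1$ (the minors that wrap around are only required to be nonzero). * $U_a\subset\Pi^\circ_{k,n}$ is given by $\Delta_{I(a,i)}\ne0$ for $1\le i\le k-1$, and $U_a^1=U_a\cap\Pi^{\circ,1}_{k,n}$. * For $V\in U_a$ and $1\le i\le k-2$ let $$u_i=v_{a+i}-\sum_{s=0}^{i-1}\frac{\Delta_{I'(a,s,i)}(V)}{\Delta_{I(a,i)}(V)}\,v_{a+s},$$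 where $I'(a,s,i)$ is obtained from the ordered set $I(a,i)$ by replacing $a+s$ by $a+i$ in the same position. Put $$V_1=(v_a,\dots,v_n),\qquad \overline{V_2}=\Bigl(v_1,\dots,v_a,u_1,\dots,u_{k-2},\frac{v_n}{\Delta_{I(a,k-1)}(V)}\Bigr).$$ * The rectangles seed of $\Pi^{\circ,1}_{k,n}$ has the algebraically independent cluster variables $\Delta_{I(b,i)}$, $1\le b\le n-k$, $1\le i\le k-1$; those with $b=1$ are frozen. Its quiver has the arrows $I(b,i)\to I(b-1,i)$, $I(b,i)\to I(b,i+1)$ and $I(b,i)\to I(b+1,i-1)$ whenever both ends are vertices and not both have $b=1$. The seed of $U_a^1$ is this seed with the variables $\Delta_{I(a,i)}$, $1\le i\le k-1$, frozen as well. The seed of a product is the disjoint union of the seeds of the factors. * Two seeds of regular functions on $X$ are quasi-equivalent if the groups $\mathbf P\subset\mathbb C[X]^\times$ of Laurent monomials in their frozen variables coincide and there is a bijection between their mutable indices such that corresponding mutable variables differ by a factor in $\mathbf P$ and corresponding exchange ratios $\hat y_i=\prod_{\varepsilon_{ij}\ge0}A_j^{\varepsilon_{ij}}\big/\prod_{\varepsilon_{ij}\le0}A_j^{-\varepsilon_{ij}}$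 coincide in $\mathbb C(X)$. **Theorem.** The map $$\overline\Phi_a:V\mapsto (V_1,\overline{V_2})$$ is well defined and is an isomorphism of varieties $U_a^1\;\simeq\;\Pi^{\circ,1}_{k,n-a+1}\times\Pi^{\circ,1}_{k,a+k-1}$. It is a quasi-cluster isomorphism: the pullback under $\overline\Phi_a$ of the product of the rectangles seeds is quasi-equivalent to the seed of $U_a^1$. -/

import Mathlib

namespace OpenPositroid

/-! ### Columns, minors and the affine cone over the Grassmannian -/

/-- The column `v_j` of a `k × n` matrix, with `j` counted from `1` and extended `n`-periodically. -/
def col {k n : ℕ} (V : Matrix (Fin k) (Fin n) ℂ) (j : ℕ) : Fin k → ℂ :=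
  fun r => if h : 0 < n then V r ⟨(j + n - 1) % n, Nat.mod_lt _ h⟩ else 0

/-- The minor `Δ_J(V) = v_{J 0} ∧ ⋯ ∧ v_{J (k-1)}` for an ordered tuple `J` of column labels. -/
def minor {k n : ℕ} (V : Matrix (Fin k) (Fin n) ℂ) (J : Fin k → ℕ) : ℂ :=
  (Matrix.of fun r s => col V (J s) r).det

/-- The labels `b, b+1, …, b+k-1`. -/
def consec {k : ℕ} (b : ℕ) : Fin k → ℕ := fun s => b + s

/-- The ordered set `I(b,i) = {b, …, b+i-1, n-k+i+1, …, n}`. -/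
def rectIdx {k : ℕ} (n b i : ℕ) : Fin k → ℕ :=
  fun s => if (s : ℕ) < i then b + s else n - k + 1 + s

/-- Two matrices are identified if they differ by left multiplication by a matrix in `SL_k`. -/
def slSetoid (k n : ℕ) : Setoid (Matrix (Fin k) (Fin n) ℂ) where
  r V W := ∃ A : Matrix.SpecialLinearGroup (Fin k) ℂ, W = A.1 * V
  iseqv :=
    { refl := fun V => ⟨1, by simp⟩
      symm := by
        rintro V W ⟨A, rfl⟩
        refine ⟨A⁻¹, ?_⟩
        have h : (A⁻¹ : Matrix.SpecialLinearGroup (Fin k) ℂ).1 * A.1 = 1 := by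
          rw [← Matrix.SpecialLinearGroup.coe_mul]; simp
        rw [← Matrix.mul_assoc, h, Matrix.one_mul]
      trans := by
        rintro V W X ⟨A, rfl⟩ ⟨B, rfl⟩
        exact ⟨B * A, by rw [Matrix.SpecialLinearGroup.coe_mul, Matrix.mul_assoc]⟩ }

/-- `k × n` matrices modulo `SL_k`. The classes of matrices of rank `k` are the nonzero points of
the affine cone over `Gr(k,n)`, and the minors are well-defined functions on it. All the loci below
consist of classes of matrices of rank `k`. -/
def Cone (k n : ℕ) : Type := Quotient (slSetoid k n)

/-- The class of a matrix. -/
def Cone.mk {k n : ℕ} (V : Matrix (Fin k) (Fin n) ℂ) : Cone k n := Quotient.mk (slSetoid k n) V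

theorem minor_mul {k n : ℕ} (A : Matrix (Fin k) (Fin k) ℂ) (V : Matrix (Fin k) (Fin n) ℂ)
    (J : Fin k → ℕ) : minor (A * V) J = A.det * minor V J := by
  unfold minor
  rw [← Matrix.det_mul]
  congr 1
  ext r s
  simp only [Matrix.of_apply, col, Matrix.mul_apply]
  split_ifs <;> simp

/-- The Plücker coordinate `Δ_J` as a function on the cone. -/
def plucker {k n : ℕ} (J : Fin k → ℕ) (x : Cone k n) : ℂ :=
  Quotient.lift (fun V => minor V J)
    (by
      rintro V W ⟨A, rfl⟩
      simp only [minor_mul, A.2, one_mul]) x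

/-- The cone over the open positroid variety `Π°_{k,n}`: all cyclically consecutive minors are
nonzero. -/
def openPositroid (k n : ℕ) : Set (Cone k n) :=
  {x | ∀ b, 1 ≤ b → b ≤ n → plucker (consec b) x ≠ 0}

/-- `Π°,1_{k,n}`: the consecutive minors `Δ_{b,…,b+k-1} = Δ_{I(b,k)}`, `1 ≤ b ≤ n-k+1`, are all
equal to `1`. Two such matrices that differ by an element of `GL_k` differ by an element of `SL_k`,
so this is also a locus in `Gr(k,n)`. -/
def normPositroid (k n : ℕ) : Set (Cone k n) :=
  {x | x ∈ openPositroid k n ∧ ∀ b, 1 ≤ b → b + k ≤ n + 1 → plucker (consec b) x = 1}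

/-- `U_a`: the minors `Δ_{I(a,i)}`, `1 ≤ i ≤ k-1`, are nonzero. -/
def openU (k n a : ℕ) : Set (Cone k n) :=
  {x | x ∈ openPositroid k n ∧ ∀ i, 1 ≤ i → i ≤ k - 1 → plucker (rectIdx n a i) x ≠ 0}

/-- `U_a^1 = U_a ∩ Π°,1_{k,n}`. -/
def normU (k n a : ℕ) : Set (Cone k n) := openU k n a ∩ normPositroid k n

/-! ### The two matrices -/

/-- The vector `u_i = v_{a+i} - ∑_{s<i} (Δ_{I'(a,s,i)} / Δ_{I(a,i)}) v_{a+s}`, where the tuple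
`I'(a,s,i)` is `I(a,i)` with the entry `a+s` (in position `s`) replaced by `a+i`. -/
noncomputable def uVec {k n : ℕ} (V : Matrix (Fin k) (Fin n) ℂ) (a i : ℕ) : Fin k → ℂ :=
  col V (a + i) - ∑ s : Fin k, if (s : ℕ) < i then
    (minor V (Function.update (rectIdx n a i) s (a + i)) / minor V (rectIdx n a i)) •
      col V (a + s) else 0

/-- `V₁ = (v_a, …, v_n)`. -/
def leftMatrix {k n : ℕ} (V : Matrix (Fin k) (Fin n) ℂ) (a : ℕ) :
    Matrix (Fin k) (Fin (n - a + 1)) ℂ :=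
  Matrix.of fun r j => col V (a + j) r

/-- `V̄₂ = (v_1, …, v_a, u_1, …, u_{k-2}, v_n / Δ_{I(a,k-1)})`. -/
noncomputable def rightMatrix {k n : ℕ} (V : Matrix (Fin k) (Fin n) ℂ) (a : ℕ) :
    Matrix (Fin k) (Fin (a + k - 1)) ℂ :=
  Matrix.of fun r j =>
    if (j : ℕ) < a then col V (j + 1) r
    else if (j : ℕ) < a + k - 2 then uVec V a (j - a + 1) r
    else col V n r / minor V (rectIdx n a (k - 1))

/-! ### Regular functions and isomorphisms -/

/-- A set of points with a family of coordinate functions, such as a subset of an affine space. -/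
class Coordinates (X : Type) where
  index : Type
  coord : index → X → ℂ

/-- The value at the point `x` of a polynomial in the coordinates. -/
noncomputable def polyEval {X : Type} [Coordinates X]
    (p : MvPolynomial (Coordinates.index X) ℂ) (x : X) : ℂ :=
  MvPolynomial.eval (fun j => Coordinates.coord j x) p

/-- The algebra `ℂ[X]` of regular functions on `X`: the functions that are, near every point in the
Zariski topology, quotients of polynomials in the coordinates. -/
noncomputable def Reg (X : Type) [Coordinates X] : Subalgebra ℂ (X → ℂ) where
  carrier := {f | ∀ x, ∃ p q : MvPolynomial (Coordinates.index X) ℂ, polyEval q x ≠ 0 ∧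
    ∀ y, polyEval q y ≠ 0 → f y = polyEval p y / polyEval q y}
  mul_mem' := by
    intro f g hf hg x
    obtain ⟨p, q, hq, h⟩ := hf x
    obtain ⟨p', q', hq', h'⟩ := hg x
    refine ⟨p * p', q * q', ?_, fun y hy => ?_⟩
    · simpa [polyEval] using ⟨hq, hq'⟩
    · have hy2 : polyEval q y ≠ 0 ∧ polyEval q' y ≠ 0 := by simpa [polyEval] using hy
      rw [Pi.mul_apply, h y hy2.1, h' y hy2.2, div_mul_div_comm]
      simp [polyEval]
  add_mem' := by
    intro f g hf hg x
    obtain ⟨p, q, hq, h⟩ := hf x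
    obtain ⟨p', q', hq', h'⟩ := hg x
    refine ⟨p * q' + q * p', q * q', ?_, fun y hy => ?_⟩
    · simpa [polyEval] using ⟨hq, hq'⟩
    · have hy2 : polyEval q y ≠ 0 ∧ polyEval q' y ≠ 0 := by simpa [polyEval] using hy
      rw [Pi.add_apply, h y hy2.1, h' y hy2.2, div_add_div _ _ hy2.1 hy2.2]
      simp [polyEval]
  algebraMap_mem' := by
    intro c x
    exact ⟨MvPolynomial.C c, 1, by simp [polyEval], fun y _ => by simp [polyEval]⟩

/-- The coordinates of a subset of the cone are the Plücker coordinates. -/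
instance coordinatesCone {k n : ℕ} (X : Set (Cone k n)) : Coordinates X where
  index := Fin k → ℕ
  coord J x := plucker J x.1

/-- The coordinates of a product are those of the two factors. -/
instance coordinatesProd (X Y : Type) [Coordinates X] [Coordinates Y] : Coordinates (X × Y) where
  index := Coordinates.index X ⊕ Coordinates.index Y
  coord j z := Sum.elim (fun i => Coordinates.coord i z.1) (fun i => Coordinates.coord i z.2) j

/-- An isomorphism of varieties: a bijection such that it and its inverse pull regular functions
back to regular functions. -/
structure VarIso (X Y : Type) [Coordinates X] [Coordinates Y] extends X ≃ Y where
  regular_toFun : ∀ g ∈ Reg Y, g ∘ toFun ∈ Reg X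
  regular_invFun : ∀ f ∈ Reg X, f ∘ invFun ∈ Reg Y

/-- The pullback of regular functions along an isomorphism. -/
noncomputable def VarIso.pullback {X Y : Type} [Coordinates X] [Coordinates Y] (φ : VarIso X Y) :
    Reg Y ≃ₐ[ℂ] Reg X where
  toFun g := ⟨g.1 ∘ φ.toFun, φ.regular_toFun g.1 g.2⟩
  invFun f := ⟨f.1 ∘ φ.invFun, φ.regular_invFun f.1 f.2⟩
  left_inv g := by
    apply Subtype.ext; funext y
    exact congrArg g.1 (φ.right_inv y)
  right_inv f := by
    apply Subtype.ext; funext x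
    exact congrArg f.1 (φ.left_inv x)
  map_mul' _ _ := rfl
  map_add' _ _ := rfl
  commutes' _ := rfl

/-! ### Seeds and quasi-equivalence -/

/-- A seed of regular functions in `R = ℂ[X]`: a quiver, given by its skew-symmetric exchange
matrix, and algebraically independent cluster variables, with a set of invertible frozen ones. -/
structure Seed (R : Type) [CommRing R] [Algebra ℂ R] (ι : Type) where
  var : ι → R
  algInd : AlgebraicIndependent ℂ var
  frozen : Set ι
  isUnit_frozen : ∀ j ∈ frozen, IsUnit (var j)
  exch : ι → ι → ℤ
  exch_skew : ∀ i j, exch i j = - exch j i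

namespace Seed

variable {R R' : Type} [CommRing R] [Algebra ℂ R] [CommRing R'] [Algebra ℂ R'] {ι κ : Type}

/-- The indices of the mutable variables. -/
def Mutable (S : Seed R ι) : Type := {j : ι // j ∉ S.frozen}

/-- The group of Laurent monomials in the frozen variables. -/
def frozenGroup (S : Seed R ι) : Subgroup Rˣ :=
  Subgroup.closure {u | ∃ j ∈ S.frozen, (u : R) = S.var j}

/-- The exchange ratio at `i`, an element of the fraction field of `R`. -/
noncomputable def exchangeRatio [Fintype ι] [IsDomain R] (S : Seed R ι) (i : ι) : FractionRing R :=
  (∏ j, algebraMap R (FractionRing R) (S.var j) ^ (S.exch i j).toNat) /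
    ∏ j, algebraMap R (FractionRing R) (S.var j) ^ (-S.exch i j).toNat

/-- Quasi-equivalence of seeds: the groups of Laurent monomials in the frozen variables coincide
and, for a suitable matching of the mutable indices, corresponding mutable variables differ by a
factor in this group and corresponding exchange ratios coincide. -/
def QuasiEquivalent [Fintype ι] [Fintype κ] [IsDomain R] (S : Seed R ι) (T : Seed R κ) : Prop :=
  S.frozenGroup = T.frozenGroup ∧
  ∃ e : S.Mutable ≃ T.Mutable, ∀ i : S.Mutable,
    (∃ m ∈ S.frozenGroup, S.var i.1 = (m : R) * T.var (e i).1) ∧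
    S.exchangeRatio i.1 = T.exchangeRatio (e i).1

/-- The image of a seed under an isomorphism of algebras. -/
def map (S : Seed R ι) (f : R ≃ₐ[ℂ] R') : Seed R' ι where
  var j := f (S.var j)
  algInd := S.algInd.map' (f := f.toAlgHom) f.injective
  frozen := S.frozen
  isUnit_frozen j hj := (S.isUnit_frozen j hj).map f
  exch := S.exch
  exch_skew := S.exch_skew

end Seed

/-! ### Facts needed for the seeds: units, the chart of the rectangles seed, integrality -/

theorem coord_mem_reg {X : Type} [Coordinates X] (j : Coordinates.index X) :
    (fun x : X => Coordinates.coord j x) ∈ Reg X := by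
  intro x
  exact ⟨MvPolynomial.X j, 1, by simp [polyEval], fun y _ => by simp [polyEval]⟩

theorem isUnit_reg {X : Type} [Coordinates X] (f : Reg X) (hf : ∀ x, f.1 x ≠ 0) : IsUnit f := by
  have hmem : (fun x => (f.1 x)⁻¹) ∈ Reg X := by
    intro x
    obtain ⟨p, q, hq, h⟩ := f.2 x
    have hp : polyEval p x ≠ 0 := by
      intro h0
      apply hf x
      rw [h x hq, h0, zero_div]
    refine ⟨q * q, p * q, ?_, fun y hy => ?_⟩
    · simpa [polyEval] using ⟨hp, hq⟩
    · have hy2 : polyEval p y ≠ 0 ∧ polyEval q y ≠ 0 := by simpa [polyEval] using hy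
      have h1 : polyEval (q * q) y = polyEval q y * polyEval q y := by simp [polyEval]
      have h2 : polyEval (p * q) y = polyEval p y * polyEval q y := by simp [polyEval]
      show (f.1 y)⁻¹ = _
      rw [h y hy2.2, h1, h2, inv_div, mul_div_mul_right _ _ hy2.2]
  refine IsUnit.of_mul_eq_one (⟨_, hmem⟩ : Reg X) ?_
  apply Subtype.ext; funext x
  exact mul_inv_cancel₀ (hf x)

theorem reg_aeval {X ι : Type} [Coordinates X] (f : ι → Reg X) (p : MvPolynomial ι ℂ) (x : X) :
    (MvPolynomial.aeval f p : Reg X).1 x = MvPolynomial.eval (fun j => (f j).1 x) p := by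
  let ev : Reg X →ₐ[ℂ] ℂ := (Pi.evalAlgHom ℂ (fun _ : X => ℂ) x).comp (Reg X).val
  have : ev (MvPolynomial.aeval f p) = MvPolynomial.aeval (fun j => ev (f j)) p := by
    rw [← MvPolynomial.comp_aeval_apply]
  rw [MvPolynomial.aeval_eq_eval] at this
  exact this

theorem algInd_of_surj {X ι : Type} [Coordinates X] [Fintype ι] (f : ι → Reg X)
    (h : ∀ z : ι → ℂ, (∀ j, z j ≠ 0) → ∃ x, ∀ j, (f j).1 x = z j) :
    AlgebraicIndependent ℂ f := by
  rw [algebraicIndependent_iff]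
  intro p hp
  have key : p * ∏ j, MvPolynomial.X j = 0 := by
    apply MvPolynomial.funext
    intro z
    by_cases hz : ∀ j, z j ≠ 0
    · obtain ⟨x, hx⟩ := h z hz
      have h1 := reg_aeval f p x
      rw [funext hx] at h1
      rw [hp] at h1
      simp only [map_mul, map_zero]
      rw [← h1]
      simp
    · push Not at hz
      obtain ⟨j, hj⟩ := hz
      simp only [map_mul, map_prod, MvPolynomial.eval_X, map_zero]
      rw [Finset.prod_eq_zero (Finset.mem_univ j) hj, mul_zero]
  rcases mul_eq_zero.1 key with h0 | h0
  · exact h0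
  · exact absurd h0 (Finset.prod_ne_zero_iff.2 fun j _ => MvPolynomial.X_ne_zero j)

/-- The determinant of the vectors `w_{J 0}, …, w_{J (k-1)}`. -/
def seqDet {k : ℕ} (w : ℕ → Fin k → ℂ) (J : Fin k → ℕ) : ℂ :=
  (Matrix.of fun r s => w (J s) r).det

theorem seqDet_congr {k : ℕ} {w w' : ℕ → Fin k → ℂ} {J : Fin k → ℕ}
    (h : ∀ s, w (J s) = w' (J s)) : seqDet w J = seqDet w' J := by
  unfold seqDet
  congr 1
  ext r s
  simp [h]

theorem chart_seq {k n : ℕ} (hk : 1 ≤ k) (hn : k ≤ n) (z : ℕ → ℕ → ℂ) (hz : ∀ b i, z b i ≠ 0)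
    (h1 : ∀ i, z (n - k + 1) i = 1) (m : ℕ) (hm : m ≤ n - k) :
    ∃ w : ℕ → Fin k → ℂ, ∀ b i, n - k + 1 ≤ b + m → b ≤ n - k + 1 → 1 ≤ i → i ≤ k →
      seqDet w (rectIdx n b i) = z b i := by
  induction m with
  | zero =>
    refine ⟨fun j r => if j = n - k + 1 + r then 1 else 0, ?_⟩
    intro b i hb hb' hi hik
    have : b = n - k + 1 := by omega
    subst this
    rw [h1]
    have : (Matrix.of fun (r s : Fin k) => (fun (j : ℕ) (r : Fin k) =>
        if j = n - k + 1 + (r : ℕ) then (1 : ℂ) else 0) (rectIdx n (n - k + 1) i s) r) = 1 := by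
      ext r s
      simp only [Matrix.of_apply, rectIdx, ite_self, Matrix.one_apply]
      congr 1
      simp [Fin.ext_iff, eq_comm]
    unfold seqDet
    rw [this, Matrix.det_one]
  | succ m ih =>
    obtain ⟨w, hw⟩ := ih (by omega)
    obtain ⟨b, hb⟩ : ∃ b, b + m = n - k := ⟨n - k - m, by omega⟩
    have : NeZero k := ⟨by omega⟩
    -- the matrix with the columns `I(b,i+1)`, the first one to be replaced
    let N : Fin k → Matrix (Fin k) (Fin k) ℂ := fun i =>
      Matrix.of fun r s => w (rectIdx n b (i + 1) s) r
    let y : Fin k → Fin k → ℂ := fun s => w (n - k + 1 + s)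
    let T : Matrix (Fin k) (Fin k) ℂ := Matrix.of fun i s => (N i).cramer (y s) 0
    have hlow : ∀ i s : Fin k, i < s → T i s = 0 := by
      intro i s his
      have his' : (i : ℕ) < s := his
      simp only [T, Matrix.of_apply, Matrix.cramer_apply]
      have h0s : (0 : Fin k) ≠ s := by
        intro h; rw [← h] at his'; simp at his'
      apply Matrix.det_zero_of_column_eq h0s
      intro r
      rw [Matrix.updateCol_self, Matrix.updateCol_ne h0s.symm]
      simp only [N, y, Matrix.of_apply, rectIdx]
      rw [if_neg (by omega)]
    have hdiag : ∀ i : Fin k, T i i ≠ 0 := by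
      intro i
      simp only [T, Matrix.of_apply, Matrix.cramer_apply]
      have hperm : ((N i).updateCol 0 (y i)).submatrix id (Fin.cycleRange i) =
          Matrix.of fun r s => w (rectIdx n (b + 1) i s) r := by
        ext r s
        simp only [Matrix.submatrix_apply, id, Matrix.of_apply]
        rcases lt_trichotomy s i with h | h | h
        · have hs : ((Fin.cycleRange i s : Fin k) : ℕ) = s + 1 := Fin.coe_cycleRange_of_lt h
          have h' : (s : ℕ) < i := h
          rw [Matrix.updateCol_ne (by intro h0; rw [h0] at hs; simp at hs)]
          simp only [N, Matrix.of_apply, rectIdx, hs]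
          rw [if_pos (by omega), if_pos h']
          congr 1; omega
        · subst h
          rw [Fin.cycleRange_self, Matrix.updateCol_self]
          simp [y, rectIdx]
        · have h' : (i : ℕ) < s := h
          rw [Fin.cycleRange_of_gt h, Matrix.updateCol_ne
            (by intro h0; rw [h0] at h'; simp at h')]
          simp only [N, Matrix.of_apply, rectIdx]
          rw [if_neg (by omega), if_neg (by omega)]
      have hdet := Matrix.det_permute' (Fin.cycleRange i) ((N i).updateCol 0 (y i))
      rw [hperm] at hdet
      intro h0
      rw [h0, mul_zero] at hdet
      rcases Nat.eq_zero_or_pos (i : ℕ) with hi | hi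
      · have h2 := hw (n - k + 1) 1 (by omega) le_rfl le_rfl hk
        have h3 : seqDet w (rectIdx n (b + 1) i) = seqDet w (rectIdx n (n - k + 1) 1) := by
          congr 1
          funext s
          simp only [rectIdx, hi, ite_self]
          rw [if_neg (by omega)]
        exact hz _ _ (h2.symm.trans (h3.symm.trans hdet))
      · exact hz _ _ ((hw (b + 1) i (by omega) (by omega) hi i.2.le).symm.trans hdet)
    have hT : IsUnit T.det := by
      rw [Matrix.det_of_isLowerTriangular T (by intro i j hij; exact hlow i j hij)]
      exact (Finset.prod_ne_zero_iff.2 fun i _ => hdiag i).isUnit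
    let c : Fin k → ℂ := T⁻¹.mulVec fun i : Fin k => z b (i + 1)
    have hc : T.mulVec c = fun i : Fin k => z b (i + 1) := by
      simp only [c]
      rw [Matrix.mulVec_mulVec, Matrix.mul_nonsing_inv _ hT, Matrix.one_mulVec]
    let x : Fin k → ℂ := ∑ s, c s • y s
    refine ⟨Function.update w b x, ?_⟩
    intro b' i hb1 hb2 hi hik
    by_cases hbb : b' = b
    · subst hbb
      have h4 : seqDet (Function.update w b' x) (rectIdx n b' i) =
          (N ⟨i - 1, by omega⟩).cramer x 0 := by
        rw [Matrix.cramer_apply]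
        unfold seqDet
        congr 1
        ext r s
        have hi1 : i - 1 + 1 = i := by omega
        rw [Matrix.updateCol_apply]
        by_cases hs : s = 0
        · subst hs
          rw [if_pos rfl]
          simp [rectIdx, show 0 < i by omega]
        · have hs0 : (s : ℕ) ≠ 0 := by
            intro h; apply hs; ext; simpa using h
          rw [if_neg hs]
          simp only [N, Matrix.of_apply, hi1]
          rw [Function.update_of_ne]
          unfold rectIdx
          split_ifs <;> omega
      rw [h4]
      have h5 : (N ⟨i - 1, by omega⟩).cramer x 0 = T.mulVec c ⟨i - 1, by omega⟩ := by
        simp only [x, map_sum, map_smul, Matrix.mulVec, dotProduct, T, Matrix.of_apply,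
          Finset.sum_apply, Pi.smul_apply, smul_eq_mul]
        exact Finset.sum_congr rfl fun s _ => mul_comm _ _
      rw [h5, hc]
      show z b' (i - 1 + 1) = z b' i
      congr 1; omega
    · rw [← hw b' i (by omega) hb2 hi hik]
      apply seqDet_congr
      intro s
      rw [Function.update_of_ne]
      unfold rectIdx
      split_ifs <;> omega

theorem col_of_seq {k n : ℕ} (w : ℕ → Fin k → ℂ) (j : ℕ) (h1 : 1 ≤ j) (h2 : j ≤ n) :
    col (Matrix.of fun r (c : Fin n) => w (c + 1) r) j = w j := by
  funext r
  unfold col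
  rw [dif_pos (by omega)]
  have : (j + n - 1) % n = j - 1 := by
    rw [show j + n - 1 = j - 1 + n by omega, Nat.add_mod_right, Nat.mod_eq_of_lt (by omega)]
  simp only [Matrix.of_apply, this]
  congr 1; omega

theorem col_add_self {k n : ℕ} (V : Matrix (Fin k) (Fin n) ℂ) (j : ℕ) (hj : 1 ≤ j) :
    col V (j + n) = col V j := by
  funext r
  unfold col
  split_ifs with h
  · congr 2
    rw [show j + n + n - 1 = (j + n - 1) + n by omega, Nat.add_mod_right]
  · rfl

/-- Up to sign, the wrapping minors are the minors `Δ_{I(1,i)}`. -/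
theorem minor_wrap {k n : ℕ} (hn : k ≤ n) (V : Matrix (Fin k) (Fin n) ℂ) (i : ℕ) (hi : 1 ≤ i)
    (hik : i < k) : minor V (consec (n - k + 1 + i)) ≠ 0 ↔ minor V (rectIdx n 1 i) ≠ 0 := by
  have : NeZero k := ⟨by omega⟩
  let σ : Equiv.Perm (Fin k) := Equiv.addRight (⟨i, hik⟩ : Fin k)
  have hdet := Matrix.det_permute' σ (Matrix.of fun r s => col V (rectIdx n 1 i s) r)
  have h2 : (Matrix.of fun r s => col V (rectIdx n 1 i s) r).submatrix id σ =
      Matrix.of fun r s => col V (consec (n - k + 1 + i) s) r := by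
    ext r s
    have hσ : ((σ s : Fin k) : ℕ) = (s + i) % k := by
      simp [σ, Fin.val_add]
    have hs := s.2
    simp only [Matrix.submatrix_apply, id, Matrix.of_apply, rectIdx, consec, hσ]
    by_cases hlt : (s : ℕ) + i < k
    · rw [Nat.mod_eq_of_lt hlt, if_neg (by omega)]
      rw [show n - k + 1 + ((s : ℕ) + i) = n - k + 1 + i + s by omega]
    · have : ((s : ℕ) + i) % k = s + i - k := by
        rw [Nat.mod_eq_sub_mod (by omega), Nat.mod_eq_of_lt (by omega)]
      rw [this, if_pos (by omega), show n - k + 1 + i + (s : ℕ) = 1 + (s + i - k) + n by omega,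
        col_add_self _ _ (by omega)]
  rw [h2] at hdet
  unfold minor
  rw [hdet]
  have hs : (((Equiv.Perm.sign σ : ℤˣ) : ℤ) : ℂ) ≠ 0 := by
    exact_mod_cast (Equiv.Perm.sign σ).ne_zero
  rw [Ne, mul_eq_zero, not_or]
  exact ⟨fun h => h.2, fun h => ⟨hs, h⟩⟩

/-- The chart of the rectangles seed: the minors `Δ_{I(b,i)}`, `1 ≤ b ≤ n-k`, `1 ≤ i ≤ k-1`, take
arbitrary nonzero values on a normalized matrix. -/
theorem exists_chart_point {k n : ℕ} (hk : 1 ≤ k) (hn : k ≤ n)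
    (z : Fin (n - k) × Fin (k - 1) → ℂ) (hz : ∀ j, z j ≠ 0) :
    ∃ x ∈ normPositroid k n,
      (∀ j : Fin (n - k) × Fin (k - 1), plucker (rectIdx n (j.1 + 1) (j.2 + 1)) x = z j) ∧
      ∀ b i, 1 ≤ b → b ≤ n - k → 1 ≤ i → i ≤ k → plucker (rectIdx n b i) x ≠ 0 := by
  let z' : ℕ → ℕ → ℂ := fun b i =>
    if h : b - 1 < n - k ∧ i - 1 < k - 1 then z (⟨b - 1, h.1⟩, ⟨i - 1, h.2⟩) else 1
  have hz' : ∀ b i, z' b i ≠ 0 := by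
    intro b i
    simp only [z']
    split_ifs
    · exact hz _
    · exact one_ne_zero
  have h1 : ∀ i, z' (n - k + 1) i = 1 := by
    intro i
    simp only [z']
    rw [dif_neg (by omega)]
  obtain ⟨w, hw⟩ := chart_seq hk hn z' hz' h1 (n - k) le_rfl
  let V : Matrix (Fin k) (Fin n) ℂ := Matrix.of fun r c => w (c + 1) r
  have hV : ∀ b i, 1 ≤ b → b ≤ n - k + 1 → 1 ≤ i → i ≤ k →
      minor V (rectIdx n b i) = z' b i := by
    intro b i hb hb' hi hik
    rw [← hw b i (by omega) hb' hi hik]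
    unfold minor seqDet
    congr 1
    ext r s
    simp only [Matrix.of_apply]
    have := s.2
    rw [col_of_seq w]
    · unfold rectIdx; split_ifs <;> omega
    · unfold rectIdx; split_ifs <;> omega
  have hcons : ∀ b, (consec b : Fin k → ℕ) = rectIdx n b k := by
    intro b
    funext s
    simp [consec, rectIdx]
  have hone : ∀ b, 1 ≤ b → b ≤ n - k + 1 → minor V (consec b) = 1 := by
    intro b hb hb'
    rw [hcons, hV b k hb hb' hk le_rfl]
    simp only [z']
    rw [dif_neg (by omega)]
  refine ⟨Cone.mk V, ⟨?_, ?_⟩, ?_, ?_⟩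
  · intro b hb hbn
    show minor V (consec b) ≠ 0
    by_cases h : b ≤ n - k + 1
    · rw [hone b hb h]; exact one_ne_zero
    · obtain ⟨i, rfl⟩ : ∃ i, b = n - k + 1 + i := ⟨b - (n - k + 1), by omega⟩
      apply (minor_wrap hn V i (by omega) (by omega)).2
      rw [hV 1 i le_rfl (by omega) (by omega) (by omega)]
      exact hz' _ _
  · intro b hb hbn
    exact hone b hb (by omega)
  · intro j
    have hj1 := j.1.2
    have hj2 := j.2.2
    show minor V _ = z j
    rw [hV _ _ (by omega) (by omega) (by omega) (by omega)]
    simp only [z']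
    rw [dif_pos (by omega)]
    rfl
  · intro b i hb hb' hi hik
    show minor V _ ≠ 0
    rw [hV b i hb (by omega) hi hik]
    exact hz' _ _

/-- Functions on a set of complex numbers that are given by a rational function of one variable. -/
def RatOn (S : Set ℂ) (g : S → ℂ) : Prop :=
  ∃ P Q : Polynomial ℂ, ∀ s : S, Q.eval s.1 ≠ 0 ∧ g s = P.eval s.1 / Q.eval s.1

theorem ratOn_poly {S : Set ℂ} (P : Polynomial ℂ) : RatOn S (fun s => P.eval s.1) :=
  ⟨P, 1, fun s => by simp⟩

theorem RatOn.mul {S : Set ℂ} {f g : S → ℂ} (hf : RatOn S f) (hg : RatOn S g) :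
    RatOn S (fun s => f s * g s) := by
  obtain ⟨P, Q, h⟩ := hf
  obtain ⟨P', Q', h'⟩ := hg
  refine ⟨P * P', Q * Q', fun s => ?_⟩
  show _ ∧ f s * g s = _
  rw [(h s).2, (h' s).2, Polynomial.eval_mul, Polynomial.eval_mul, div_mul_div_comm]
  exact ⟨mul_ne_zero (h s).1 (h' s).1, rfl⟩

theorem RatOn.add {S : Set ℂ} {f g : S → ℂ} (hf : RatOn S f) (hg : RatOn S g) :
    RatOn S (fun s => f s + g s) := by
  obtain ⟨P, Q, h⟩ := hf
  obtain ⟨P', Q', h'⟩ := hg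
  refine ⟨P * Q' + Q * P', Q * Q', fun s => ?_⟩
  show _ ∧ f s + g s = _
  rw [(h s).2, (h' s).2, div_add_div _ _ (h s).1 (h' s).1]
  simp [(h s).1, (h' s).1]

theorem RatOn.inv {S : Set ℂ} {f : S → ℂ} (hf : RatOn S f) (h0 : ∀ s, f s ≠ 0) :
    RatOn S (fun s => (f s)⁻¹) := by
  obtain ⟨P, Q, h⟩ := hf
  refine ⟨Q, P, fun s => ⟨fun hP => h0 s ?_, ?_⟩⟩
  · rw [(h s).2, hP, zero_div]
  · show (f s)⁻¹ = _
    rw [(h s).2, inv_div]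

theorem RatOn.prod {S : Set ℂ} {α : Type} (A : Finset α) {f : α → S → ℂ}
    (hf : ∀ a ∈ A, RatOn S (f a)) : RatOn S (fun s => ∏ a ∈ A, f a s) := by
  classical
  induction A using Finset.induction_on with
  | empty => simpa using ratOn_poly (S := S) 1
  | insert a A ha ih =>
    simp only [Finset.prod_insert ha]
    exact (hf a (Finset.mem_insert_self a A)).mul
      (ih fun b hb => hf b (Finset.mem_insert_of_mem hb))

theorem RatOn.finite_zeros {S : Set ℂ} {f : S → ℂ} (hf : RatOn S f) (s₀ : S) (h0 : f s₀ ≠ 0) :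
    {t : ℂ | ∃ h : t ∈ S, f ⟨t, h⟩ = 0}.Finite := by
  obtain ⟨P, Q, h⟩ := hf
  have hP : P ≠ 0 := by
    rintro rfl
    apply h0
    rw [(h s₀).2]; simp
  apply (Polynomial.finite_setOfPred_isRoot hP).subset
  rintro t ⟨ht, h1⟩
  rw [(h ⟨t, ht⟩).2, div_eq_zero_iff] at h1
  exact h1.resolve_right (h ⟨t, ht⟩).1

/-- If any two points lie on a rational curve, then the algebra of regular functions is a domain. -/
theorem isDomain_reg {X : Type} [Coordinates X] [Nonempty X]
    (hX : ∀ x y : X, ∃ S : Set ℂ, Sᶜ.Finite ∧ ∃ γ : S → X, (∃ s, γ s = x) ∧ (∃ s, γ s = y) ∧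
      ∀ j, RatOn S (fun s => Coordinates.coord j (γ s))) : IsDomain (Reg X) := by
  have : NoZeroDivisors (Reg X) := by
    refine ⟨fun {f g} hfg => ?_⟩
    by_contra hcon
    push Not at hcon
    have hex : ∀ f : Reg X, f ≠ 0 → ∃ x, f.1 x ≠ 0 := by
      intro f hf
      by_contra h
      push Not at h
      exact hf (Subtype.ext (funext h))
    obtain ⟨x, hx⟩ := hex f hcon.1
    obtain ⟨y, hy⟩ := hex g hcon.2
    obtain ⟨S, hS, γ, ⟨s, hs⟩, ⟨s', hs'⟩, hγ⟩ := hX x y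
    have hpoly : ∀ p : MvPolynomial (Coordinates.index X) ℂ,
        RatOn S (fun s => polyEval p (γ s)) := by
      intro p
      induction p using MvPolynomial.induction_on with
      | C c => simpa [polyEval] using ratOn_poly (S := S) (Polynomial.C c)
      | add p q hp hq => simpa [polyEval] using hp.add hq
      | mul_X p j hp => simpa [polyEval] using hp.mul (hγ j)
    have hfin : ∀ (f : Reg X) (s : S), f.1 (γ s) ≠ 0 →
        ∃ Z : Set ℂ, Z.Finite ∧ ∀ t : S, t.1 ∉ Z → f.1 (γ t) ≠ 0 := by
      intro f s hf
      obtain ⟨p, q, hq, h⟩ := f.2 (γ s)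
      have hp : polyEval p (γ s) ≠ 0 := by
        intro h0
        apply hf
        rw [h _ hq, h0, zero_div]
      refine ⟨_, ((hpoly p).finite_zeros s hp).union ((hpoly q).finite_zeros s hq), ?_⟩
      intro t ht
      have h1 : polyEval p (γ t) ≠ 0 := fun h0 => ht (Or.inl ⟨t.2, h0⟩)
      have h2 : polyEval q (γ t) ≠ 0 := fun h0 => ht (Or.inr ⟨t.2, h0⟩)
      rw [h _ h2]
      exact div_ne_zero h1 h2
    obtain ⟨Z, hZ, hZ'⟩ := hfin f s (by rwa [hs])
    obtain ⟨Y, hY, hY'⟩ := hfin g s' (by rwa [hs'])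
    obtain ⟨t, ht⟩ := ((hS.union hZ).union hY).infinite_compl.nonempty
    simp only [Set.mem_compl_iff, Set.mem_union, not_or, not_not] at ht
    have h1 := hZ' ⟨t, ht.1.1⟩ ht.1.2
    have h2 := hY' ⟨t, ht.1.1⟩ ht.2
    have h3 : f.1 (γ ⟨t, ht.1.1⟩) * g.1 (γ ⟨t, ht.1.1⟩) = 0 :=
      congrFun (congrArg Subtype.val hfg) (γ ⟨t, ht.1.1⟩)
    exact (mul_ne_zero h1 h2) h3
  have : Nontrivial (Reg X) := by
    refine ⟨⟨0, 1, fun h => ?_⟩⟩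
    obtain ⟨x⟩ := ‹Nonempty X›
    exact zero_ne_one (congrFun (congrArg Subtype.val h) x)
  exact NoZeroDivisors.to_isDomain _

/-- Factors for the columns that turn consecutive minors `D b` into `1`. -/
noncomputable def colScale (k : ℕ) (D : ℕ → ℂ) (j : ℕ) : ℂ :=
  if j ≤ 1 then (D 1)⁻¹ else if _h : j ≤ k ∨ k = 0 then 1 else
    colScale k D (j - k) * (D (j - k) * (D (j - k + 1))⁻¹)
termination_by j
decreasing_by omega

theorem colScale_one (k : ℕ) (D : ℕ → ℂ) : colScale k D 1 = (D 1)⁻¹ := by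
  rw [colScale, if_pos le_rfl]

theorem colScale_small {k : ℕ} (D : ℕ → ℂ) {j : ℕ} (h1 : 1 < j) (h2 : j ≤ k) :
    colScale k D j = 1 := by
  rw [colScale, if_neg (by omega), dif_pos (Or.inl h2)]

theorem colScale_add {k : ℕ} (hk : 1 ≤ k) (D : ℕ → ℂ) {j : ℕ} (h1 : 1 ≤ j) :
    colScale k D (j + k) = colScale k D j * (D j * (D (j + 1))⁻¹) := by
  rw [colScale, if_neg (by omega), dif_neg (by omega), Nat.add_sub_cancel]

/-- Induction along `j ↦ j + k`. -/
theorem colScale_induction {k n : ℕ} (hk : 1 ≤ k) {P : ℕ → Prop} (h1 : P 1)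
    (h2 : ∀ j, 1 < j → j ≤ k → P j) (h3 : ∀ j, 1 ≤ j → j + k ≤ n → P j → P (j + k)) (j : ℕ)
    (hj : 1 ≤ j) (hjn : j ≤ n) : P j := by
  induction j using Nat.strong_induction_on with
  | _ j ih =>
    rcases Nat.lt_or_ge 1 j with h | h
    · rcases Nat.lt_or_ge k j with h' | h'
      · have := h3 (j - k) (by omega) (by omega) (ih (j - k) (by omega) (by omega) (by omega))
        rwa [Nat.sub_add_cancel h'.le] at this
      · exact h2 j h h'
    · obtain rfl : j = 1 := by omega
      exact h1

theorem colScale_prod {k n : ℕ} (hk : 1 ≤ k) (D : ℕ → ℂ)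
    (hD : ∀ b, 1 ≤ b → b + k ≤ n + 1 → D b ≠ 0) (b : ℕ) (hb : 1 ≤ b) (hbn : b + k ≤ n + 1) :
    ∏ s : Fin k, colScale k D (b + s) = (D b)⁻¹ := by
  rw [Fin.prod_univ_eq_prod_range (fun s => colScale k D (b + s)) k]
  induction b, hb using Nat.le_induction with
  | base =>
    rw [Finset.prod_eq_single 0]
    · exact colScale_one k D
    · intro s hs hs0
      have := Finset.mem_range.1 hs
      exact colScale_small D (by omega) (by omega)
    · intro h; exact absurd (Finset.mem_range.2 hk) h
  | succ b hb ih =>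
    have ih := ih (by omega)
    have h1 := Finset.prod_range_succ (fun s => colScale k D (b + s)) k
    have h2 := Finset.prod_range_succ' (fun s => colScale k D (b + s)) k
    rw [h1, ih, colScale_add hk D hb] at h2
    simp only [Nat.add_zero] at h2
    have hDb := hD b hb (by omega)
    have hDb' := hD (b + 1) (by omega) hbn
    have h0 : colScale k D b ≠ 0 := by
      intro h0
      rw [Finset.prod_eq_zero (Finset.mem_range.2 hk) (by simpa using h0)] at ih
      exact inv_ne_zero hDb ih.symm
    have h3 : ∏ s ∈ Finset.range k, colScale k D (b + 1 + s) =
        ∏ s ∈ Finset.range k, colScale k D (b + (s + 1)) :=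
      Finset.prod_congr rfl fun s _ => by rw [show b + 1 + s = b + (s + 1) by omega]
    rw [h3]
    apply mul_right_cancel₀ h0
    rw [← h2]
    field_simp

/-- Rescaling the columns. -/
noncomputable def rescale {k n : ℕ} (V : Matrix (Fin k) (Fin n) ℂ) : Matrix (Fin k) (Fin n) ℂ :=
  Matrix.of fun r c => V r c * colScale k (fun b => minor V (consec b)) (c + 1)

theorem minor_rescale {k n : ℕ} (hn : 0 < n) (V : Matrix (Fin k) (Fin n) ℂ) (J : Fin k → ℕ) :
    minor (rescale V) J =
      (∏ s, colScale k (fun b => minor V (consec b)) ((J s + n - 1) % n + 1)) * minor V J := by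
  have h := Matrix.det_mul_row
    (fun s => colScale k (fun b => minor V (consec b)) ((J s + n - 1) % n + 1))
    (Matrix.of fun r s => col V (J s) r)
  refine Eq.trans ?_ h
  show Matrix.det _ = _
  congr 1
  ext r s
  simp only [Matrix.of_apply, col, dif_pos hn, rescale]
  rw [mul_comm]

theorem isDomain_reg_normU {k n a : ℕ} (hk : 1 ≤ k) (ha : 1 ≤ a) (han : a + k ≤ n) :
    IsDomain (Reg (normU k n a)) := by
  have hn : 0 < n := by omega
  have : Nonempty (normU k n a) := by
    obtain ⟨x, hx, -, h⟩ := exists_chart_point hk (by omega : k ≤ n) (fun _ => 1) (by simp)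
    exact ⟨x, ⟨hx.1, fun i hi hik => h a i ha (by omega) hi (by omega)⟩, hx⟩
  apply isDomain_reg
  rintro ⟨x, hx⟩ ⟨y, hy⟩
  obtain ⟨M, rfl⟩ := Quotient.exists_rep x
  obtain ⟨N, rfl⟩ := Quotient.exists_rep y
  let W : ℂ → Matrix (Fin k) (Fin n) ℂ := fun t => (1 - t) • M + t • N
  have hW0 : W 0 = M := by simp [W]
  have hW1 : W 1 = N := by simp [W]
  have hpoly : ∀ J : Fin k → ℕ, ∃ P : Polynomial ℂ, ∀ t, minor (W t) J = P.eval t := by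
    intro J
    refine ⟨(Matrix.of fun r s => (1 - Polynomial.X) * Polynomial.C (col M (J s) r) +
      Polynomial.X * Polynomial.C (col N (J s) r)).det, fun t => ?_⟩
    rw [← Polynomial.coe_evalRingHom, RingHom.map_det]
    unfold minor
    congr 1
    ext r s
    simp [W, col, hn]
    exact mul_comm _ _
  have hfin : ∀ J : Fin k → ℕ, minor M J ≠ 0 → {t | minor (W t) J = 0}.Finite := by
    intro J hJ
    obtain ⟨P, hP⟩ := hpoly J
    have hP0 : P ≠ 0 := by
      rintro rfl
      apply hJ
      rw [← hW0, hP]; simp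
    apply (Polynomial.finite_setOfPred_isRoot hP0).subset
    intro t ht
    show P.eval t = 0
    rw [← hP]; exact ht
  let S : Set ℂ := {t | (∀ b, 1 ≤ b → b ≤ n → minor (W t) (consec b) ≠ 0) ∧
    ∀ i, 1 ≤ i → i ≤ k - 1 → minor (W t) (rectIdx n a i) ≠ 0}
  have hS : Sᶜ.Finite := by
    have h1 : (⋃ b ∈ Set.Icc 1 n, {t | minor (W t) (consec b) = 0}).Finite :=
      (Set.finite_Icc 1 n).biUnion fun b hb => hfin _ (hx.1.1 b hb.1 hb.2)
    have h2 : (⋃ i ∈ Set.Icc 1 (k - 1), {t | minor (W t) (rectIdx n a i) = 0}).Finite :=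
      (Set.finite_Icc 1 (k - 1)).biUnion fun b hb => hfin _ (hx.1.2 b hb.1 hb.2)
    apply (h1.union h2).subset
    intro t ht
    by_contra hcon
    simp only [Set.mem_union, Set.mem_iUnion, not_or, not_exists] at hcon
    exact ht ⟨fun b hb hb' h0 => hcon.1 b ⟨hb, hb'⟩ h0, fun b hb hb' h0 => hcon.2 b ⟨hb, hb'⟩ h0⟩
  have hscale0 : ∀ s : S, ∀ j, 1 ≤ j → j ≤ n →
      colScale k (fun b => minor (W s) (consec b)) j ≠ 0 := by
    intro s j hj hjn
    refine colScale_induction (n := n) hk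
      (P := fun j => colScale k (fun b => minor (W s) (consec b)) j ≠ 0) ?_ ?_ ?_ j hj hjn
    · rw [colScale_one]
      exact inv_ne_zero (s.2.1 1 le_rfl hn)
    · intro j h1 h2
      rw [colScale_small _ h1 h2]
      exact one_ne_zero
    · intro j h1 h2 h3
      rw [colScale_add hk _ h1]
      exact mul_ne_zero h3 (mul_ne_zero (s.2.1 j h1 (by omega))
        (inv_ne_zero (s.2.1 (j + 1) (by omega) (by omega))))
  have hlab : ∀ j, 1 ≤ (j + n - 1) % n + 1 ∧ (j + n - 1) % n + 1 ≤ n := fun j =>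
    ⟨by omega, Nat.mod_lt _ hn⟩
  have hne : ∀ (s : S) (J : Fin k → ℕ), minor (W s) J ≠ 0 → minor (rescale (W s)) J ≠ 0 := by
    intro s J hJ
    rw [minor_rescale hn]
    exact mul_ne_zero
      (Finset.prod_ne_zero_iff.2 fun r _ => hscale0 s _ (hlab _).1 (hlab _).2) hJ
  have hmem : ∀ s : S, Cone.mk (rescale (W s)) ∈ normU k n a := by
    intro s
    have hop : Cone.mk (rescale (W s)) ∈ openPositroid k n := fun b hb hb' =>
      hne s _ (s.2.1 b hb hb')
    refine ⟨⟨hop, fun i hi hi' => hne s _ (s.2.2 i hi hi')⟩, hop, fun b hb hb' => ?_⟩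
    show minor (rescale (W s)) (consec b) = 1
    rw [minor_rescale hn]
    have h1 : ∀ r : Fin k, ((consec b : Fin k → ℕ) r + n - 1) % n + 1 = b + r := by
      intro r
      have := r.2
      simp only [consec]
      rw [show b + (r : ℕ) + n - 1 = b + r - 1 + n by omega, Nat.add_mod_right,
        Nat.mod_eq_of_lt (by omega)]
      omega
    simp only [h1]
    rw [colScale_prod (n := n) hk _ (fun b hb hb' => s.2.1 b hb (by omega)) b hb hb']
    exact inv_mul_cancel₀ (s.2.1 b hb (by omega))
  have hfix : ∀ V : Matrix (Fin k) (Fin n) ℂ, Cone.mk V ∈ normU k n a → rescale V = V := by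
    intro V hV
    have hD : ∀ b, 1 ≤ b → b + k ≤ n + 1 → minor V (consec b) = 1 := hV.2.2
    have h1 : ∀ j, 1 ≤ j → j ≤ n → colScale k (fun b => minor V (consec b)) j = 1 := by
      intro j hj hjn
      refine colScale_induction (n := n) hk
        (P := fun j => colScale k (fun b => minor V (consec b)) j = 1) ?_ ?_ ?_ j hj hjn
      · rw [colScale_one, hD 1 le_rfl (by omega), inv_one]
      · intro j h1 h2
        exact colScale_small _ h1 h2
      · intro j h1 h2 h3
        rw [colScale_add hk _ h1, h3, hD j h1 (by omega), hD (j + 1) (by omega) (by omega)]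
        simp
    ext r c
    have := c.2
    simp only [rescale, Matrix.of_apply]
    rw [h1 _ (by omega) (by omega), mul_one]
  have h0S : (0 : ℂ) ∈ S := by
    simp only [S, Set.mem_ofPred_eq, hW0]
    exact ⟨hx.1.1, hx.1.2⟩
  have h1S : (1 : ℂ) ∈ S := by
    simp only [S, Set.mem_ofPred_eq, hW1]
    exact ⟨hy.1.1, hy.1.2⟩
  refine ⟨S, hS, fun s => ⟨Cone.mk (rescale (W s)), hmem s⟩, ⟨⟨0, h0S⟩, ?_⟩, ⟨⟨1, h1S⟩, ?_⟩, ?_⟩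
  · apply Subtype.ext
    show Cone.mk (rescale (W 0)) = Cone.mk M
    rw [hW0, hfix M hx]
  · apply Subtype.ext
    show Cone.mk (rescale (W 1)) = Cone.mk N
    rw [hW1, hfix N hy]
  · intro J
    have hrat : ∀ J : Fin k → ℕ, RatOn S (fun s => minor (W s) J) := by
      intro J
      obtain ⟨P, hP⟩ := hpoly J
      simp only [hP]
      exact ratOn_poly P
    have hsc : ∀ j, 1 ≤ j → j ≤ n →
        RatOn S (fun s => colScale k (fun b => minor (W s) (consec b)) j) := by
      intro j hj hjn
      refine colScale_induction (n := n) hk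
        (P := fun j => RatOn S (fun s => colScale k (fun b => minor (W s) (consec b)) j))
        ?_ ?_ ?_ j hj hjn
      · simp only [colScale_one]
        exact (hrat _).inv fun s => s.2.1 1 le_rfl hn
      · intro j h1 h2
        simp only [colScale_small _ h1 h2]
        simpa using ratOn_poly (S := S) 1
      · intro j h1 h2 h3
        simp only [colScale_add hk _ h1]
        exact h3.mul ((hrat _).mul
          ((hrat _).inv fun s => s.2.1 (j + 1) (by omega) (by omega)))
    show RatOn S (fun s => minor (rescale (W s)) J)
    simp only [minor_rescale hn]
    exact (RatOn.prod _ fun r _ => hsc _ (hlab _).1 (hlab _).2).mul (hrat J)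

/-! ### The rectangles seeds -/

/-- The minor `Δ_{I(b,i)}` as a regular function on a subset of the cone. -/
noncomputable def rectVar {k n : ℕ} (X : Set (Cone k n)) (b i : ℕ) : Reg X :=
  ⟨fun x => plucker (rectIdx n b i) x.1, coord_mem_reg (X := X) (rectIdx n b i)⟩

/-- The arrows `I(b,i) → I(b-1,i)`, `I(b,i) → I(b,i+1)` and `I(b,i) → I(b+1,i-1)` of the rectangles
quiver, without arrows between two vertices with `b = 1`. The pair `(p, q)` stands for `I(p+1,q+1)`.
The vertices `I(b,k)`, whose minors are `1`, are removed. -/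
def RectArrow {m l : ℕ} (x y : Fin m × Fin l) : Prop :=
  ¬ ((x.1 : ℕ) = 0 ∧ (y.1 : ℕ) = 0) ∧
  (((y.1 : ℕ) + 1 = x.1 ∧ (y.2 : ℕ) = x.2) ∨
   ((y.1 : ℕ) = x.1 ∧ (y.2 : ℕ) = x.2 + 1) ∨
   ((y.1 : ℕ) = x.1 + 1 ∧ (y.2 : ℕ) + 1 = x.2))

instance {m l : ℕ} (x y : Fin m × Fin l) : Decidable (RectArrow x y) := by
  unfold RectArrow; infer_instance

/-- The exchange matrix of the rectangles quiver. -/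
def rectExch {m l : ℕ} (x y : Fin m × Fin l) : ℤ :=
  (if RectArrow x y then 1 else 0) - (if RectArrow y x then 1 else 0)

theorem rectExch_skew {m l : ℕ} (x y : Fin m × Fin l) : rectExch x y = - rectExch y x := by
  unfold rectExch; ring

theorem plucker_first_ne_zero {k n : ℕ} (hn : k ≤ n) {x : Cone k n} (hx : x ∈ openPositroid k n)
    (i : ℕ) (hi : 1 ≤ i) (hik : i < k) : plucker (rectIdx n 1 i) x ≠ 0 := by
  obtain ⟨V, rfl⟩ := Quotient.exists_rep x
  exact (minor_wrap hn V i hi hik).1 (hx _ (by omega) (by omega))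

/-- The rectangles seed of `Π°,1_{k,n}`: the variables are `Δ_{I(b,i)}`, `1 ≤ b ≤ n-k`,
`1 ≤ i ≤ k-1`, and the frozen ones are those with `b = 1`. -/
noncomputable def normSeed {k n : ℕ} (hk : 1 ≤ k) (hn : k ≤ n) :
    Seed (Reg (normPositroid k n)) (Fin (n - k) × Fin (k - 1)) where
  var p := rectVar (normPositroid k n) (p.1 + 1) (p.2 + 1)
  algInd := algInd_of_surj _ fun z hz => by
    obtain ⟨x, hx, h, -⟩ := exists_chart_point hk hn z hz
    exact ⟨⟨x, hx⟩, h⟩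
  frozen := {p | (p.1 : ℕ) + 1 = 1}
  isUnit_frozen p hp := isUnit_reg _ fun x => by
    have := p.2.2
    show plucker (rectIdx n (p.1 + 1) (p.2 + 1)) x.1 ≠ 0
    rw [show (p.1 : ℕ) + 1 = 1 from hp]
    exact plucker_first_ne_zero hn x.2.1 _ (by omega) (by omega)
  exch := rectExch
  exch_skew := rectExch_skew

/-- The seed of `U_a^1` obtained from the rectangles seed by freezing the variables `Δ_{I(a,i)}`. -/
noncomputable def frozenSeed {k n a : ℕ} (hk : 1 ≤ k) (ha : 1 ≤ a) (han : a + k ≤ n) :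
    Seed (Reg (normU k n a)) (Fin (n - k) × Fin (k - 1)) where
  var p := rectVar (normU k n a) (p.1 + 1) (p.2 + 1)
  algInd := algInd_of_surj _ fun z hz => by
    obtain ⟨x, hx, h, h'⟩ := exists_chart_point hk (by omega : k ≤ n) z hz
    exact ⟨⟨x, ⟨hx.1, fun i hi hik => h' a i ha (by omega) hi (by omega)⟩, hx⟩, h⟩
  frozen := {p | (p.1 : ℕ) + 1 = 1 ∨ (p.1 : ℕ) + 1 = a}
  isUnit_frozen p hp := isUnit_reg _ fun x => by
    have := p.2.2
    show plucker (rectIdx n (p.1 + 1) (p.2 + 1)) x.1 ≠ 0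
    rcases hp with hp | hp
    · rw [hp]
      exact plucker_first_ne_zero (by omega) x.2.1.1 _ (by omega) (by omega)
    · rw [hp]
      exact x.2.1.2 _ (by omega) (by omega)
  exch := rectExch
  exch_skew := rectExch_skew

/-! ### The seed of a product -/

theorem polyEval_comp {X Y : Type} [Coordinates X] [Coordinates Y] (π : Y → X)
    (f : Coordinates.index X → Coordinates.index Y)
    (h : ∀ j y, Coordinates.coord (f j) y = Coordinates.coord j (π y))
    (p : MvPolynomial (Coordinates.index X) ℂ) (y : Y) :
    polyEval (MvPolynomial.rename f p) y = polyEval p (π y) := by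
  unfold polyEval
  rw [MvPolynomial.eval_rename]
  congr 2
  funext j
  exact h j y

theorem comp_mem_reg {X Y : Type} [Coordinates X] [Coordinates Y] (π : Y → X)
    (f : Coordinates.index X → Coordinates.index Y)
    (h : ∀ j y, Coordinates.coord (f j) y = Coordinates.coord j (π y)) (g : Reg X) :
    g.1 ∘ π ∈ Reg Y := by
  intro y
  obtain ⟨p, q, hq, hpq⟩ := g.2 (π y)
  refine ⟨MvPolynomial.rename f p, MvPolynomial.rename f q, ?_, fun z hz => ?_⟩
  · rwa [polyEval_comp π f h]
  · rw [polyEval_comp π f h] at hz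
    rw [polyEval_comp π f h, polyEval_comp π f h]
    exact hpq _ hz

/-- The pullback of a regular function along the first projection. -/
noncomputable def pullFst {X : Type} (Y : Type) [Coordinates X] [Coordinates Y] (g : Reg X) :
    Reg (X × Y) :=
  ⟨g.1 ∘ Prod.fst, comp_mem_reg (Y := X × Y) Prod.fst Sum.inl (fun _ _ => rfl) g⟩

/-- The pullback of a regular function along the second projection. -/
noncomputable def pullSnd (X : Type) {Y : Type} [Coordinates X] [Coordinates Y] (g : Reg Y) :
    Reg (X × Y) :=
  ⟨g.1 ∘ Prod.snd, comp_mem_reg (Y := X × Y) Prod.snd Sum.inr (fun _ _ => rfl) g⟩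

theorem algInd_prod {X Y ι κ : Type} [Coordinates X] [Coordinates Y] {f : ι → Reg X}
    {g : κ → Reg Y} (hf : AlgebraicIndependent ℂ f) (hg : AlgebraicIndependent ℂ g) :
    AlgebraicIndependent ℂ
      (Sum.elim (fun i => pullFst Y (f i)) (fun j => pullSnd X (g j)) : ι ⊕ κ → Reg (X × Y)) := by
  rw [algebraicIndependent_iff] at hf hg ⊢
  intro p hp
  obtain ⟨q, rfl⟩ := (MvPolynomial.sumAlgEquiv ℂ ι κ).symm.surjective p
  have hval : ∀ x y, MvPolynomial.eval (fun i => (f i).1 x)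
      (MvPolynomial.map (MvPolynomial.eval fun j => (g j).1 y) q) = 0 := by
    intro x y
    have h1 := reg_aeval (Sum.elim (fun i => pullFst Y (f i)) (fun j => pullSnd X (g j)))
      ((MvPolynomial.sumAlgEquiv ℂ ι κ).symm q) (x, y)
    rw [hp] at h1
    have h2 : MvPolynomial.eval (fun i => (f i).1 x)
        (MvPolynomial.map (MvPolynomial.eval fun j => (g j).1 y) q) =
        MvPolynomial.eval (fun j => (Sum.elim (fun i => pullFst Y (f i))
          (fun j => pullSnd X (g j)) j).1 (x, y)) ((MvPolynomial.sumAlgEquiv ℂ ι κ).symm q) := by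
      clear hp h1
      induction q using MvPolynomial.induction_on with
      | C c =>
        rw [MvPolynomial.map_C, MvPolynomial.eval_C]
        induction c using MvPolynomial.induction_on with
        | C c => rw [MvPolynomial.sumAlgEquiv_symm_C_C]; simp
        | add c d hc hd => simp only [map_add, hc, hd]
        | mul_X c j hc =>
          simp only [map_mul, hc]
          rw [MvPolynomial.sumAlgEquiv_symm_C_X]; simp [pullSnd]
      | add p q hp hq => simp only [map_add, hp, hq]
      | mul_X p i hp =>
        simp only [map_mul, hp]
        rw [MvPolynomial.sumAlgEquiv_symm_X]; simp [pullFst]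
    rw [h2, ← h1]
    rfl
  have hq : q = 0 := by
    ext1 m
    rw [MvPolynomial.coeff_zero]
    apply hg
    apply Subtype.ext
    funext y
    rw [reg_aeval]
    have h3 : MvPolynomial.map (MvPolynomial.eval fun j => (g j).1 y) q = 0 := by
      apply hf
      apply Subtype.ext
      funext x
      rw [reg_aeval]
      exact hval x y
    rw [← MvPolynomial.coeff_map, h3, MvPolynomial.coeff_zero]
    rfl
  rw [hq, map_zero]

/-- The seed of a product of two varieties: the disjoint union of the two seeds. -/
noncomputable def Seed.prod {X Y ι κ : Type} [Coordinates X] [Coordinates Y]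
    (S : Seed (Reg X) ι) (T : Seed (Reg Y) κ) : Seed (Reg (X × Y)) (ι ⊕ κ) where
  var := Sum.elim (fun i => pullFst Y (S.var i)) (fun j => pullSnd X (T.var j))
  algInd := algInd_prod S.algInd T.algInd
  frozen := {j | Sum.elim (· ∈ S.frozen) (· ∈ T.frozen) j}
  isUnit_frozen := by
    rintro (i | j) h
    · obtain ⟨b, hb⟩ := isUnit_iff_exists_inv.1 (S.isUnit_frozen i h)
      refine IsUnit.of_mul_eq_one (pullFst Y b) ?_
      apply Subtype.ext; funext z
      exact congrFun (congrArg Subtype.val hb) z.1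
    · obtain ⟨b, hb⟩ := isUnit_iff_exists_inv.1 (T.isUnit_frozen j h)
      refine IsUnit.of_mul_eq_one (pullSnd X b) ?_
      apply Subtype.ext; funext z
      exact congrFun (congrArg Subtype.val hb) z.2
  exch i j := match i, j with
    | Sum.inl i, Sum.inl i' => S.exch i i'
    | Sum.inr j, Sum.inr j' => T.exch j j'
    | _, _ => 0
  exch_skew := by
    rintro (i | i) (j | j)
    · exact S.exch_skew i j
    · simp
    · simp
    · exact T.exch_skew i j

end OpenPositroid

open OpenPositroid

namespace OpenPositroid

/-! The vectors `u_i` lie on the intersection of two opposite flags. By definition `u_i` is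
`v_{a+i}` plus a combination of `v_a, …, v_{a+i-1}`. Cramer's rule in the basis with labels `I(a,i)`
shows that it is also a combination of the last `k-i` columns `v_{n-k+i+1}, …, v_n`, in which
`v_{n-k+i+1}` has coefficient `Δ_{I(a,i+1)} / Δ_{I(a,i)}` (`uVec_sub_mem_span_Ioi`). For `i = k-1`
this identifies `u_{k-1}` with the last column `v_n / Δ_{I(a,k-1)}` of `V̄₂`, so the columns of
`V̄₂` from `a` on are exactly `u_0, …, u_{k-1}`.

Both descriptions are triangular, so they compute minors. In `Δ_{I(b,i)}(V̄₂)` with `b ≤ a`, the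
first `i` columns may be replaced by those of `V` without change, while the last `k-i` contribute a
product of diagonal coefficients that telescopes to `1 / Δ_{I(a,i)}(V)`. This gives `Δ_{I(b,i)}(V̄₂)
= Δ_{I(b,i)}(V) / Δ_{I(a,i)}(V)` (`minor_rightMatrix_rectIdx`), the formula on which everything
rests. The minors of `V₁` that matter are simply minors of `V`. Hence the normalization and
nonvanishing conditions pass between `V` and its two parts.

For the inverse, `V₁` determines the `u_i`, which form a basis of determinant one. The class of the
second matrix `Y` has a unique representative whose columns `a, …, a+k-1` are these `u_i`; its first
columns complete `V₁` to `V`. Coordinates with respect to the columns `a, …, a+k-1` of `Y` are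
minors of `Y`, so the inverse is regular and independent of representatives.

On seeds, the left factor gives the variables with `b ≥ a` unchanged, and the right factor gives
those with `b < a` divided by the frozen `Δ_{I(a,i)}`. The frozen groups therefore agree. The
exchange ratios agree because, at a mutable vertex below row `a`, the exponents in each column of
the grid sum to zero (`sum_rectWeight`), so a common factor along a column cancels. -/

theorem one_le_of_two_le {k : ℕ} (hk : 2 ≤ k) : 1 ≤ k := by omega

theorem le_left_width {k n a : ℕ} (han : a + k ≤ n) : k ≤ n - a + 1 := by omega

theorem le_right_width {k a : ℕ} (ha : 1 ≤ a) : k ≤ a + k - 1 := by omega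

/-! ### Triangular changes of columns -/

/-- The coefficients assemble into an upper triangular matrix `T` with diagonal `d`, and the two
matrices of vectors differ by right multiplication by `T`. -/
theorem det_of_sub_mem_span_lt {k : ℕ} (v w : Fin k → Fin k → ℂ) (d : Fin k → ℂ)
    (h : ∀ s, w s - d s • v s ∈ Submodule.span ℂ (v '' Set.Iio s)) :
    (Matrix.of fun r s => w s r).det = (∏ s, d s) * (Matrix.of fun r s => v s r).det := by
  have h' : ∀ s, ∃ c : Fin k → ℂ, ∑ i ∈ Finset.Iio s, c i • v i = w s - d s • v s := by
    intro s
    apply (Submodule.mem_span_image_finset_iff_exists_fun' ℂ).1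
    simpa using h s
  choose c hc using h'
  let T : Matrix (Fin k) (Fin k) ℂ :=
    Matrix.of fun t s => if t < s then c s t else if t = s then d s else 0
  have hT : T.IsUpperTriangular := by
    intro t s hts
    have hts : s < t := hts
    simp [T, hts.not_gt, hts.ne']
  have hmul : (Matrix.of fun r s => w s r) = (Matrix.of fun r s => v s r) * T := by
    ext r s
    have h1 : w s = d s • v s + ∑ i ∈ Finset.Iio s, c s i • v i := by rw [hc]; abel
    have h2 : ∀ t, v t r * T t s =
        (if t = s then d s * v s r else 0) + if t < s then c s t * v t r else 0 := by
      intro t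
      rcases lt_trichotomy t s with h | rfl | h
      · simp [T, h, h.ne, mul_comm]
      · simp [T, mul_comm]
      · simp [T, h.not_gt, h.ne']
    simp only [Matrix.mul_apply, Matrix.of_apply, h2, Finset.sum_add_distrib, h1]
    rw [Finset.sum_ite_eq', if_pos (Finset.mem_univ s), ← Finset.sum_filter]
    simp only [Pi.add_apply, Pi.smul_apply, Finset.sum_apply, smul_eq_mul]
    congr 2
    ext t; simp
  rw [hmul, Matrix.det_mul, Matrix.det_of_isUpperTriangular hT, mul_comm]
  simp [T]

/-- Reversing the order of the vectors reduces this to the previous lemma; both determinants acquire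
the same sign, which cancels. -/
theorem det_of_sub_mem_span_gt {k : ℕ} (v w : Fin k → Fin k → ℂ) (d : Fin k → ℂ)
    (h : ∀ s, w s - d s • v s ∈ Submodule.span ℂ (v '' Set.Ioi s)) :
    (Matrix.of fun r s => w s r).det = (∏ s, d s) * (Matrix.of fun r s => v s r).det := by
  have key := det_of_sub_mem_span_lt (v ∘ Fin.rev) (w ∘ Fin.rev) (d ∘ Fin.rev) (fun s => by
    have := h s.rev
    rwa [show (v ∘ Fin.rev) '' Set.Iio s = v '' Set.Ioi s.rev by
      rw [Set.image_comp]
      congr 1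
      ext t
      simp only [Set.mem_image, Set.mem_Iio, Set.mem_Ioi]
      exact ⟨fun ⟨x, hx, hxt⟩ => hxt ▸ Fin.rev_lt_rev.2 hx,
        fun ht => ⟨t.rev, by rwa [← Fin.rev_lt_rev, Fin.rev_rev], Fin.rev_rev t⟩⟩])
  have hrev : ∀ x : Fin k → Fin k → ℂ, (Matrix.of fun r s => (x ∘ Fin.rev) s r).det =
      (Equiv.Perm.sign (Fin.revPerm : Equiv.Perm (Fin k)) : ℤ) *
        (Matrix.of fun r s => x s r).det := by
    intro x
    rw [← Matrix.det_permute']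
    rfl
  have hd : ∏ s, (d ∘ Fin.rev) s = ∏ s, d s := Equiv.prod_comp Fin.revPerm d
  rw [hrev, hrev, hd, mul_left_comm] at key
  refine mul_left_cancel₀ ?_ key
  exact_mod_cast (Equiv.Perm.sign (Fin.revPerm : Equiv.Perm (Fin k))).ne_zero

theorem prod_ite_div_telescope {k : ℕ} (g : ℕ → ℂ) (i : ℕ) (hik : i ≤ k)
    (hg : ∀ s, i ≤ s → s ≤ k → g s ≠ 0) :
    ∏ s : Fin k, (if (s : ℕ) < i then 1 else g (s + 1) / g s) = g k / g i := by
  rw [Fin.prod_univ_eq_prod_range (fun s => if s < i then 1 else g (s + 1) / g s) k]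
  induction k, hik using Nat.le_induction with
  | base =>
    rw [Finset.prod_eq_one]
    · rw [div_self (hg i le_rfl le_rfl)]
    · intro s hs
      rw [if_pos (Finset.mem_range.1 hs)]
  | succ k hk ih =>
    rw [Finset.prod_range_succ, ih fun s h1 h2 => hg s h1 (by omega), if_neg (by omega)]
    have := hg k hk (by omega)
    have := hg i le_rfl (by omega)
    field_simp

/-! ### The vectors `u_i` -/

theorem consec_eq_rectIdx {k : ℕ} (n b : ℕ) : (consec b : Fin k → ℕ) = rectIdx n b k := by
  funext s
  simp [consec, rectIdx]

theorem rectIdx_zero {k : ℕ} (n b : ℕ) : (rectIdx n b 0 : Fin k → ℕ) = consec (n - k + 1) := by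
  funext s
  simp [consec, rectIdx]

theorem col_mul {k n : ℕ} (A : Matrix (Fin k) (Fin k) ℂ) (V : Matrix (Fin k) (Fin n) ℂ) (j : ℕ) :
    col (A * V) j = A.mulVec (col V j) := by
  funext r
  simp only [col, Matrix.mul_apply, Matrix.mulVec, dotProduct]
  split_ifs <;> simp

theorem uVec_mul {k n : ℕ} (A : Matrix (Fin k) (Fin k) ℂ) (hA : A.det = 1)
    (V : Matrix (Fin k) (Fin n) ℂ) (a i : ℕ) : uVec (A * V) a i = A.mulVec (uVec V a i) := by
  simp only [uVec, col_mul, minor_mul, hA, one_mul, Matrix.mulVec_sub, Matrix.mulVec_sum]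
  congr 1
  refine Finset.sum_congr rfl fun s _ => ?_
  split_ifs
  · rw [Matrix.mulVec_smul]
  · rw [Matrix.mulVec_zero]

theorem uVec_zero {k n : ℕ} (V : Matrix (Fin k) (Fin n) ℂ) (a : ℕ) : uVec V a 0 = col V a := by
  simp [uVec]

/-- Cramer's rule for the columns of a matrix. -/
theorem minor_smul_col {k n : ℕ} (V : Matrix (Fin k) (Fin n) ℂ) (J : Fin k → ℕ) (j : ℕ) :
    minor V J • col V j = ∑ s, minor V (Function.update J s j) • col V (J s) := by
  have h := Matrix.mulVec_cramer (Matrix.of fun r s => col V (J s) r) (col V j)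
  have hm : ∀ s, Matrix.cramer (Matrix.of fun r s => col V (J s) r) (col V j) s =
      minor V (Function.update J s j) := by
    intro s
    rw [Matrix.cramer_apply]
    unfold minor
    congr 1
    ext r t
    by_cases hts : t = s
    · subst hts; simp
    · simp [hts]
  refine h.symm.trans ?_
  funext r
  simp only [Matrix.mulVec, dotProduct, hm, Matrix.of_apply, Finset.sum_apply, Pi.smul_apply,
    smul_eq_mul]
  exact Finset.sum_congr rfl fun s _ => mul_comm _ _

/-- In the expansion of `v_{a+i}` in the basis with labels `I(a,i)`, the subtracted sum in `uVec` is
exactly the part supported on `v_a, …, v_{a+i-1}`; what remains lies in the span of the last `k-i`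
columns. -/
theorem uVec_eq_sum {k n : ℕ} (V : Matrix (Fin k) (Fin n) ℂ) (a i : ℕ)
    (h0 : minor V (rectIdx n a i) ≠ 0) :
    uVec V a i = ∑ s : Fin k, if (s : ℕ) < i then 0 else
      (minor V (Function.update (rectIdx n a i) s (a + i)) / minor V (rectIdx n a i)) •
        col V (n - k + 1 + s) := by
  have h := minor_smul_col V (rectIdx n a i) (a + i)
  have h1 : col V (a + i) = ∑ s : Fin k,
      (minor V (Function.update (rectIdx n a i) s (a + i)) / minor V (rectIdx n a i)) •
        col V (rectIdx n a i s) := by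
    rw [← inv_smul_smul₀ h0 (col V (a + i)), h, Finset.smul_sum]
    refine Finset.sum_congr rfl fun s _ => ?_
    rw [smul_smul, div_eq_inv_mul]
  unfold uVec
  rw [h1, ← Finset.sum_sub_distrib]
  refine Finset.sum_congr rfl fun s _ => ?_
  simp only [rectIdx]
  split_ifs <;> simp

theorem update_rectIdx_self {k n a : ℕ} (i : Fin k) :
    Function.update (rectIdx n a i : Fin k → ℕ) i (a + i) = rectIdx n a (i + 1) := by
  funext s
  by_cases hs : s = i
  · subst hs; simp [rectIdx]
  · have : (s : ℕ) ≠ i := fun h => hs (Fin.ext h)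
    simp only [Function.update_of_ne hs, rectIdx]
    split_ifs <;> omega

/-- Replacing entry `i` of `I(a,i)` by `a+i` yields `I(a,i+1)`, which identifies the leading
coefficient. This is the triangularity of the `u_i` with respect to the last `k` columns. -/
theorem uVec_sub_mem_span_Ioi {k n : ℕ} (V : Matrix (Fin k) (Fin n) ℂ) (a : ℕ) (i : Fin k)
    (h0 : minor V (rectIdx n a i) ≠ 0) :
    uVec V a i - (minor V (rectIdx n a (i + 1)) / minor V (rectIdx n a i)) •
      col V (n - k + 1 + i) ∈
      Submodule.span ℂ ((fun s : Fin k => col V (n - k + 1 + s)) '' Set.Ioi i) := by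
  rw [uVec_eq_sum V a i h0, Finset.sum_eq_add_sum_sdiff_singleton_of_mem (Finset.mem_univ i),
    if_neg (lt_irrefl _), update_rectIdx_self, add_sub_cancel_left]
  refine Submodule.sum_mem _ fun s hs => ?_
  have hs : s ≠ i := by simpa using hs
  split_ifs with h
  · exact Submodule.zero_mem _
  · refine Submodule.smul_mem _ _ (Submodule.subset_span ⟨s, ?_, rfl⟩)
    exact lt_of_le_of_ne (Fin.le_def.2 (not_lt.1 h)) hs.symm

/-- The opposite triangularity, unipotent with respect to `v_a, v_{a+1}, …`; it needs no
nonvanishing. -/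
theorem uVec_sub_col_mem_span {k n : ℕ} (V : Matrix (Fin k) (Fin n) ℂ) (a i : ℕ) :
    uVec V a i - col V (a + i) ∈
      Submodule.span ℂ {x | ∃ s < i, x = col V (a + s)} := by
  unfold uVec
  rw [sub_sub_cancel_left]
  refine Submodule.neg_mem _ (Submodule.sum_mem _ fun s _ => ?_)
  split_ifs with h
  · exact Submodule.smul_mem _ _ (Submodule.subset_span ⟨s, h, rfl⟩)
  · exact Submodule.zero_mem _

theorem uVec_last {k n : ℕ} (hk : 1 ≤ k) (hn : k ≤ n) (V : Matrix (Fin k) (Fin n) ℂ) (a : ℕ)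
    (h0 : minor V (rectIdx n a (k - 1)) ≠ 0) (h1 : minor V (consec a) = 1) :
    uVec V a (k - 1) = (minor V (rectIdx n a (k - 1)))⁻¹ • col V n := by
  have h := uVec_sub_mem_span_Ioi V a ⟨k - 1, by omega⟩ h0
  -- No position exceeds `k-1`, so the remainder lies in the zero space and only the leading term
  -- survives.
  have hI : Set.Ioi (⟨k - 1, by omega⟩ : Fin k) = ∅ := by
    ext s
    have := s.2
    simp only [Set.mem_Ioi, Fin.lt_def, Set.mem_empty_iff_false, iff_false]
    omega
  rw [hI, Set.image_empty, Submodule.span_empty, Submodule.mem_bot, sub_eq_zero] at h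
  simp only at h
  rw [h, show k - 1 + 1 = k by omega, ← consec_eq_rectIdx, h1,
    show n - k + 1 + (k - 1) = n by omega, one_div]

/-! ### Normalized matrices -/

/-- The columns from `a` on are normalized, and the minors `Δ_{I(a,i)}` do not vanish. -/
def NormalFrom {k n : ℕ} (V : Matrix (Fin k) (Fin n) ℂ) (a : ℕ) : Prop :=
  (∀ b, a ≤ b → b + k ≤ n + 1 → minor V (consec b) = 1) ∧
    ∀ i, 1 ≤ i → i ≤ k - 1 → minor V (rectIdx n a i) ≠ 0

/-- The wrapping consecutive minors agree up to sign with `Δ_{I(1,i)}`, so only rectangle minors and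
non-wrapping consecutive minors have to be followed through the map. -/
theorem mk_mem_normPositroid {k n : ℕ} (hn : k ≤ n) {V : Matrix (Fin k) (Fin n) ℂ} :
    Cone.mk V ∈ normPositroid k n ↔ NormalFrom V 1 := by
  constructor
  · rintro ⟨h, h1⟩
    refine ⟨h1, fun i hi hik => ?_⟩
    exact (minor_wrap hn V i hi (by omega)).1 (h _ (by omega) (by omega))
  · rintro ⟨h1, h⟩
    refine ⟨fun b hb hbn => ?_, h1⟩
    show minor V (consec b) ≠ 0
    by_cases hb' : b + k ≤ n + 1
    · rw [h1 b hb hb']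
      exact one_ne_zero
    · obtain ⟨i, rfl⟩ : ∃ i, b = n - k + 1 + i := ⟨b - (n - k + 1), by omega⟩
      exact (minor_wrap hn V i (by omega) (by omega)).2 (h i (by omega) (by omega))

theorem mk_mem_normU {k n a : ℕ} (hn : k ≤ n) (ha : 1 ≤ a) {V : Matrix (Fin k) (Fin n) ℂ} :
    Cone.mk V ∈ normU k n a ↔ NormalFrom V 1 ∧ NormalFrom V a := by
  rw [← mk_mem_normPositroid hn]
  constructor
  · rintro ⟨h, h'⟩
    exact ⟨h', fun b hb => h'.2 b (ha.trans hb), h.2⟩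
  · rintro ⟨h, h'⟩
    exact ⟨⟨h.1, h'.2⟩, h⟩

/-- The extreme cases `i = 0` and `i = k` are consecutive minors, hence equal to one. They are the
ends of the telescoping product. -/
theorem NormalFrom.minor_ne_zero {k n a : ℕ} {V : Matrix (Fin k) (Fin n) ℂ}
    (h : NormalFrom V a) (han : a + k ≤ n) {i : ℕ} (hi : i ≤ k) :
    minor V (rectIdx n a i) ≠ 0 := by
  rcases Nat.eq_zero_or_pos i with rfl | h0
  · rw [rectIdx_zero, h.1 _ (by omega) (by omega)]
    exact one_ne_zero
  · rcases hi.eq_or_lt with rfl | hik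
    · rw [← consec_eq_rectIdx, h.1 a le_rfl (by omega)]
      exact one_ne_zero
    · exact h.2 i h0 (by omega)

theorem col_eq {k n : ℕ} (V : Matrix (Fin k) (Fin n) ℂ) {j : ℕ} (h1 : 1 ≤ j) (h2 : j ≤ n) :
    col V j = fun r => V r ⟨j - 1, by omega⟩ := by
  funext r
  unfold col
  rw [dif_pos (by omega)]
  congr 2
  rw [show j + n - 1 = j - 1 + n by omega, Nat.add_mod_right, Nat.mod_eq_of_lt (by omega)]

theorem ext_col {k n : ℕ} {V W : Matrix (Fin k) (Fin n) ℂ}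
    (h : ∀ j, 1 ≤ j → j ≤ n → col V j = col W j) : V = W := by
  ext r j
  have h1 := congrFun (h (j + 1) (by omega) (by omega)) r
  rwa [col_eq V (by omega) (by omega), col_eq W (by omega) (by omega)] at h1

theorem col_leftMatrix {k n a : ℕ} (V : Matrix (Fin k) (Fin n) ℂ) {j : ℕ} (h1 : 1 ≤ j)
    (h2 : j ≤ n - a + 1) : col (leftMatrix V a) j = col V (a + j - 1) := by
  rw [col_eq _ h1 h2]
  funext r
  simp only [leftMatrix, Matrix.of_apply]
  rw [show a + (j - 1) = a + j - 1 by omega]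

theorem minor_congr {k n m : ℕ} {V : Matrix (Fin k) (Fin n) ℂ} {W : Matrix (Fin k) (Fin m) ℂ}
    {J K : Fin k → ℕ} (h : ∀ s, col V (J s) = col W (K s)) : minor V J = minor W K := by
  unfold minor
  congr 1
  ext r s
  simp [h]

theorem minor_leftMatrix_rectIdx {k n a b i : ℕ} (V : Matrix (Fin k) (Fin n) ℂ) (ha : 1 ≤ a)
    (han : a + k ≤ n) (hb : 1 ≤ b) (hbn : a + b + i ≤ n + 2) :
    minor (leftMatrix V a) (rectIdx (n - a + 1) b i) = minor V (rectIdx n (a + b - 1) i) := by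
  refine minor_congr fun s => ?_
  have := s.2
  simp only [rectIdx]
  split_ifs
  · rw [col_leftMatrix V (by omega) (by omega)]
    congr 1; omega
  · rw [col_leftMatrix V (by omega) (by omega)]
    congr 1; omega

theorem minor_leftMatrix_consec {k n a b : ℕ} (V : Matrix (Fin k) (Fin n) ℂ) (ha : 1 ≤ a)
    (han : a + k ≤ n) (hb : 1 ≤ b) (hbn : a + b + k ≤ n + 2) :
    minor (leftMatrix V a) (consec b) = minor V (consec (a + b - 1)) := by
  rw [consec_eq_rectIdx (n - a + 1), minor_leftMatrix_rectIdx V ha han hb hbn,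
    ← consec_eq_rectIdx]

/-- The converse direction serves the inverse map, where only the left part of the glued matrix is
known to be normalized. -/
theorem normalFrom_leftMatrix {k n a : ℕ} (V : Matrix (Fin k) (Fin n) ℂ) (ha : 1 ≤ a)
    (han : a + k ≤ n) : NormalFrom (leftMatrix V a) 1 ↔ NormalFrom V a := by
  unfold NormalFrom
  have h1 : ∀ i, 1 ≤ i → i ≤ k - 1 →
      minor (leftMatrix V a) (rectIdx (n - a + 1) 1 i) = minor V (rectIdx n a i) := by
    intro i hi hik
    rw [minor_leftMatrix_rectIdx V ha han le_rfl (by omega), Nat.add_sub_cancel]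
  constructor
  · rintro ⟨h, h'⟩
    refine ⟨fun b hb hbn => ?_, fun i hi hik => h1 i hi hik ▸ h' i hi hik⟩
    rw [← h (b - a + 1) (by omega) (by omega),
      minor_leftMatrix_consec V ha han (by omega) (by omega)]
    congr 2; omega
  · rintro ⟨h, h'⟩
    refine ⟨fun b hb hbn => ?_, fun i hi hik => h1 i hi hik ▸ h' i hi hik⟩
    rw [minor_leftMatrix_consec V ha han hb (by omega), h _ (by omega) (by omega)]

/-- The vector `u_i` involves only columns with labels from `a` to `n`, so it can be read off from
`V₁` alone. -/
theorem uVec_leftMatrix {k n a i : ℕ} (V : Matrix (Fin k) (Fin n) ℂ) (ha : 1 ≤ a)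
    (han : a + k ≤ n) (hi : i < k) : uVec (leftMatrix V a) 1 i = uVec V a i := by
  have hcol : ∀ j, j ≤ n - a → col (leftMatrix V a) (1 + j) = col V (a + j) := by
    intro j hj
    rw [col_leftMatrix V (by omega) (by omega)]
    congr 1; omega
  unfold uVec
  rw [hcol i (by omega), minor_leftMatrix_rectIdx V ha han le_rfl (by omega),
    Nat.add_sub_cancel]
  congr 1
  refine Finset.sum_congr rfl fun s _ => ?_
  split_ifs with hs
  · rw [hcol s (by omega)]
    congr 2
    refine minor_congr fun t => ?_
    have := t.2
    by_cases hts : t = s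
    · subst hts
      simp only [Function.update_self]
      exact hcol i (by omega)
    · simp only [Function.update_of_ne hts, rectIdx]
      split_ifs
      · exact hcol t (by omega)
      · rw [show n - a + 1 - k + 1 + (t : ℕ) = 1 + (n - a + 1 - k + t) by omega,
          hcol _ (by omega)]
        congr 1; omega
  · rfl

theorem col_rightMatrix_of_le {k n a j : ℕ} (hk : 2 ≤ k) (V : Matrix (Fin k) (Fin n) ℂ)
    (h1 : 1 ≤ j) (h2 : j ≤ a) : col (rightMatrix V a) j = col V j := by
  rw [col_eq _ h1 (by omega)]
  funext r
  simp only [rightMatrix, Matrix.of_apply]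
  rw [if_pos (by omega), show j - 1 + 1 = j by omega]

/-- One formula covers the three kinds of columns: `v_a` is `u_0`, and the rescaled `v_n` is
`u_{k-1}` by `uVec_last`. -/
theorem col_rightMatrix_add {k n a i : ℕ} (hk : 2 ≤ k) (ha : 1 ≤ a) (han : a + k ≤ n)
    {V : Matrix (Fin k) (Fin n) ℂ} (hV : NormalFrom V a) (hi : i < k) :
    col (rightMatrix V a) (a + i) = uVec V a i := by
  rcases Nat.eq_zero_or_pos i with rfl | h0
  · rw [uVec_zero, add_zero, col_rightMatrix_of_le hk V ha le_rfl]
  · rw [col_eq _ (by omega) (by omega)]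
    funext r
    simp only [rightMatrix, Matrix.of_apply]
    rw [if_neg (by omega)]
    split_ifs with h
    · congr 1; omega
    · obtain rfl : i = k - 1 := by omega
      rw [uVec_last (by omega) (by omega) V a (hV.2 _ (by omega) le_rfl) (hV.1 a le_rfl (by omega))]
      simp [div_eq_inv_mul]

/-- The two triangularities of the `u_i` are used in turn, on the first `i` columns and on the last
`k-i` columns. The normalization `Δ_{I(a,k)} = 1` makes the telescoped factor `1 / Δ_{I(a,i)}`. -/
theorem minor_rightMatrix_rectIdx {k n a b i : ℕ} (hk : 2 ≤ k) (ha : 1 ≤ a) (han : a + k ≤ n)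
    {V : Matrix (Fin k) (Fin n) ℂ} (hV : NormalFrom V a) (hb : 1 ≤ b) (hba : b ≤ a)
    (hi : i ≤ k) :
    minor (rightMatrix V a) (rectIdx (a + k - 1) b i) =
      minor V (rectIdx n b i) / minor V (rectIdx n a i) := by
  -- An intermediate matrix: its first `i` columns come from `V̄₂` and the others from `V`, so that
  -- each comparison is triangular in one direction only.
  let M : Fin k → Fin k → ℂ := fun s =>
    if (s : ℕ) < i then col (rightMatrix V a) (b + s) else col V (n - k + 1 + s)
  have h1 : (Matrix.of fun r s => M s r).det = (∏ _s : Fin k, 1) * minor V (rectIdx n b i) := by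
    refine det_of_sub_mem_span_lt (fun s => col V (rectIdx n b i s)) M (fun _ => 1) fun s => ?_
    have := s.2
    simp only [M, rectIdx, one_smul]
    split_ifs with hs
    · by_cases hsa : b + s ≤ a
      · rw [col_rightMatrix_of_le hk V (by omega) hsa, sub_self]
        exact Submodule.zero_mem _
      · obtain ⟨j, hj⟩ : ∃ j, b + s = a + j := ⟨b + s - a, by omega⟩
        rw [hj, col_rightMatrix_add hk ha han hV (by omega)]
        refine Submodule.span_mono ?_ (uVec_sub_col_mem_span V a j)
        rintro x ⟨t, ht, rfl⟩
        -- The column `v_{a+t}` sits at position `a+t-b`, which is before position `s` because `a+t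
        -- < a+j = b+s`.
        refine ⟨⟨a + t - b, by omega⟩, Fin.lt_def.2 (by simp only; omega), ?_⟩
        simp only
        rw [if_pos (by omega)]
        congr 1; omega
    · rw [sub_self]
      exact Submodule.zero_mem _
  have h2 : minor (rightMatrix V a) (rectIdx (a + k - 1) b i) =
      (∏ s : Fin k, if (s : ℕ) < i then 1 else
        minor V (rectIdx n a (s + 1)) / minor V (rectIdx n a s)) *
        (Matrix.of fun r s => M s r).det := by
    refine det_of_sub_mem_span_gt M
      (fun s => col (rightMatrix V a) (rectIdx (a + k - 1) b i s)) _ fun s => ?_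
    have := s.2
    simp only [M, rectIdx]
    split_ifs with hs
    · rw [one_smul, sub_self]
      exact Submodule.zero_mem _
    · rw [show a + k - 1 - k + 1 + (s : ℕ) = a + s by omega, col_rightMatrix_add hk ha han hV s.2]
      refine Submodule.span_mono ?_
        (uVec_sub_mem_span_Ioi V a s (hV.minor_ne_zero han s.2.le))
      rintro x ⟨t, ht, rfl⟩
      have ht' : (s : ℕ) < t := ht
      refine ⟨t, ht, ?_⟩
      simp only
      rw [if_neg (by omega)]
  rw [h2, h1, prod_ite_div_telescope (fun s => minor V (rectIdx n a s)) i hi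
    (fun s _ h => hV.minor_ne_zero han h)]
  simp only [Finset.prod_const_one, one_mul]
  rw [← consec_eq_rectIdx, hV.1 a le_rfl (by omega), one_div, div_eq_inv_mul]

/-- For `i = k` the denominator in the minor formula is one, so consecutive minors starting at `b ≤
a` are unchanged; for smaller `i` it is nonzero. Consecutive minors starting after `a` are covered
by the hypothesis on `V`. -/
theorem normalFrom_rightMatrix {k n a : ℕ} (hk : 2 ≤ k) (ha : 1 ≤ a) (han : a + k ≤ n)
    {V : Matrix (Fin k) (Fin n) ℂ} (hV : NormalFrom V a) :
    NormalFrom (rightMatrix V a) 1 ↔ NormalFrom V 1 := by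
  have hc : ∀ b, 1 ≤ b → b ≤ a →
      minor (rightMatrix V a) (consec b) = minor V (consec b) := by
    intro b hb hba
    rw [consec_eq_rectIdx (a + k - 1), minor_rightMatrix_rectIdx hk ha han hV hb hba le_rfl,
      ← consec_eq_rectIdx n, ← consec_eq_rectIdx n, hV.1 a le_rfl (by omega), div_one,
      ← consec_eq_rectIdx]
  have hr : ∀ i, i ≤ k - 1 → (minor (rightMatrix V a) (rectIdx (a + k - 1) 1 i) ≠ 0 ↔
      minor V (rectIdx n 1 i) ≠ 0) := by
    intro i hi
    rw [minor_rightMatrix_rectIdx hk ha han hV le_rfl ha (by omega), Ne, div_eq_zero_iff,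
      or_iff_left (hV.minor_ne_zero han (by omega))]
  constructor
  · rintro ⟨h, h'⟩
    refine ⟨fun b hb hbn => ?_, fun i hi hik => (hr i hik).1 (h' i hi hik)⟩
    by_cases hba : b ≤ a
    · rw [← hc b hb hba, h b hb (by omega)]
    · exact hV.1 b (by omega) hbn
  · rintro ⟨h, h'⟩
    refine ⟨fun b hb hbn => ?_, fun i hi hik => (hr i hik).2 (h' i hi hik)⟩
    rw [hc b hb (by omega), h b hb (by omega)]

/-! ### The inverse map -/

/-- The matrix with right part `X` whose first columns are the images of those of `Y` under the
linear map that sends the columns `a, …, a+k-1` of `Y` to the vectors `u_0, …, u_{k-1}` of `X`. -/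
noncomputable def glue {k n a : ℕ} (X : Matrix (Fin k) (Fin (n - a + 1)) ℂ)
    (Y : Matrix (Fin k) (Fin (a + k - 1)) ℂ) : Matrix (Fin k) (Fin n) ℂ :=
  Matrix.of fun r j =>
    if (j : ℕ) + 1 < a then
      (∑ i : Fin k, minor Y (Function.update (consec a) i (j + 1)) • uVec X 1 i) r
    else col X (j + 2 - a) r

theorem col_glue_of_lt {k n a j : ℕ} (X : Matrix (Fin k) (Fin (n - a + 1)) ℂ)
    (Y : Matrix (Fin k) (Fin (a + k - 1)) ℂ) (h1 : 1 ≤ j) (h2 : j < a) (han : a ≤ n) :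
    col (glue X Y : Matrix (Fin k) (Fin n) ℂ) j =
      ∑ i : Fin k, minor Y (Function.update (consec a) i j) • uVec X 1 i := by
  rw [col_eq _ h1 (by omega)]
  funext r
  simp only [glue, Matrix.of_apply]
  rw [if_pos (by omega), show j - 1 + 1 = j by omega]

theorem col_glue_of_ge {k n a j : ℕ} (X : Matrix (Fin k) (Fin (n - a + 1)) ℂ)
    (Y : Matrix (Fin k) (Fin (a + k - 1)) ℂ) (h1 : 1 ≤ a) (h2 : a ≤ j) (hj : j ≤ n) :
    col (glue X Y : Matrix (Fin k) (Fin n) ℂ) j = col X (j + 1 - a) := by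
  rw [col_eq _ (by omega) hj]
  funext r
  simp only [glue, Matrix.of_apply]
  rw [if_neg (by omega), show j - 1 + 2 - a = j + 1 - a by omega]

theorem leftMatrix_glue {k n a : ℕ} (ha : 1 ≤ a) (han : a ≤ n)
    (X : Matrix (Fin k) (Fin (n - a + 1)) ℂ) (Y : Matrix (Fin k) (Fin (a + k - 1)) ℂ) :
    leftMatrix (glue X Y : Matrix (Fin k) (Fin n) ℂ) a = X := by
  refine ext_col fun j h1 h2 => ?_
  rw [col_leftMatrix _ h1 h2, col_glue_of_ge X Y ha (by omega) (by omega)]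
  congr 1; omega

/-- A normalized matrix is recovered from its two parts. -/
theorem glue_leftMatrix_rightMatrix {k n a : ℕ} (hk : 2 ≤ k) (ha : 1 ≤ a) (han : a + k ≤ n)
    {V : Matrix (Fin k) (Fin n) ℂ} (hV : NormalFrom V a) :
    glue (leftMatrix V a) (rightMatrix V a) = V := by
  refine ext_col fun j h1 h2 => ?_
  by_cases hj : j < a
  · rw [col_glue_of_lt _ _ h1 hj (by omega)]
    have h := minor_smul_col (rightMatrix V a) (consec a) j
    have h3 : minor (rightMatrix V a) (consec a) = 1 := by
      have h3 := minor_rightMatrix_rectIdx hk ha han hV ha le_rfl le_rfl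
      rwa [← consec_eq_rectIdx, ← consec_eq_rectIdx, hV.1 a le_rfl (by omega), div_one] at h3
    rw [h3, one_smul, col_rightMatrix_of_le hk V h1 hj.le] at h
    rw [h]
    refine Finset.sum_congr rfl fun i _ => ?_
    rw [uVec_leftMatrix V ha han i.2]
    simp only [consec]
    rw [col_rightMatrix_add hk ha han hV i.2]
  · rw [col_glue_of_ge _ _ ha (by omega) h2, col_leftMatrix _ (by omega) (by omega)]
    congr 1; omega

/-- The linear map that sends the columns `a, …, a+k-1` of `Y` to the vectors `u_i` of `X`. -/
noncomputable def glueMatrix {k m l : ℕ} (X : Matrix (Fin k) (Fin m) ℂ)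
    (Y : Matrix (Fin k) (Fin l) ℂ) (a : ℕ) : Matrix (Fin k) (Fin k) ℂ :=
  (Matrix.of fun (r i : Fin k) => uVec X 1 i r) *
    (Matrix.of fun (r s : Fin k) => col Y (consec a s) r).adjugate

/-- With the adjugate in place of an inverse, Cramer's rule turns the coordinates of a column of `Y`
into minors of `Y` without any division. Thus the first columns of `glue X Y` are images of columns
of `Y` under `glueMatrix`. -/
theorem glueMatrix_mulVec_col {k m l : ℕ} (X : Matrix (Fin k) (Fin m) ℂ)
    (Y : Matrix (Fin k) (Fin l) ℂ) (a j : ℕ) :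
    (glueMatrix X Y a).mulVec (col Y j) =
      ∑ i : Fin k, minor Y (Function.update (consec a) i j) • uVec X 1 i := by
  unfold glueMatrix
  rw [← Matrix.mulVec_mulVec, ← Matrix.cramer_eq_adjugate_mulVec]
  funext r
  simp only [Matrix.mulVec, dotProduct, Finset.sum_apply, Pi.smul_apply, Matrix.of_apply,
    smul_eq_mul]
  refine Finset.sum_congr rfl fun i _ => ?_
  rw [mul_comm, Matrix.cramer_apply]
  congr 1
  unfold minor
  congr 1
  ext r t
  by_cases hts : t = i
  · subst hts; simp
  · simp [hts]

theorem glueMatrix_mulVec_col_add {k m l : ℕ} (X : Matrix (Fin k) (Fin m) ℂ)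
    (Y : Matrix (Fin k) (Fin l) ℂ) (a : ℕ) (hY : minor Y (consec a) = 1) {i : ℕ} (hi : i < k) :
    (glueMatrix X Y a).mulVec (col Y (a + i)) = uVec X 1 i := by
  rw [glueMatrix_mulVec_col, Finset.sum_eq_single ⟨i, hi⟩]
  · rw [show Function.update (consec a) (⟨i, hi⟩ : Fin k) (a + i) = consec a from
      Function.update_eq_self (⟨i, hi⟩ : Fin k) (consec a), hY, one_smul]
  · intro s _ hs
    -- The column `a+i` now occurs twice, at positions `s` and `i`.
    have h0 : minor Y (Function.update (consec a) s (a + i)) = 0 := by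
      refine Matrix.det_zero_of_column_eq hs fun r => ?_
      simp [hs.symm, consec]
    rw [h0, zero_smul]
  · intro h; exact absurd (Finset.mem_univ _) h

/-- The `u_i` of `X` are the consecutive columns of `rightMatrix X 1`, so this is the minor formula
with `a = b = 1` and `i = k`. -/
theorem det_uVec {k m : ℕ} (hk : 2 ≤ k) (hm : 1 + k ≤ m) {X : Matrix (Fin k) (Fin m) ℂ}
    (hX : NormalFrom X 1) : (Matrix.of fun (r i : Fin k) => uVec X 1 i r).det = 1 := by
  have h := minor_rightMatrix_rectIdx hk le_rfl hm hX le_rfl le_rfl le_rfl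
  rw [← consec_eq_rectIdx, ← consec_eq_rectIdx, hX.1 1 le_rfl (by omega), div_one] at h
  rw [← h]
  unfold minor
  congr 1
  ext r i
  simp only [Matrix.of_apply, consec]
  rw [col_rightMatrix_add hk le_rfl hm hX i.2]

theorem det_glueMatrix {k m l : ℕ} (hk : 2 ≤ k) (hm : 1 + k ≤ m) {X : Matrix (Fin k) (Fin m) ℂ}
    (hX : NormalFrom X 1) (Y : Matrix (Fin k) (Fin l) ℂ) (a : ℕ) (hY : minor Y (consec a) = 1) :
    (glueMatrix X Y a).det = 1 := by
  unfold glueMatrix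
  rw [Matrix.det_mul, det_uVec hk hm hX, Matrix.det_adjugate,
    show (Matrix.of fun (r s : Fin k) => col Y (consec a s) r).det = 1 from hY, one_pow, one_mul]

/-- Both sides have the `u_i` of `X` as columns from `a` on, and the earlier columns agree by
construction of `glue`. As `glueMatrix` has determinant one here, the second part of the glued
matrix represents the class of `Y`. -/
theorem rightMatrix_glue {k n a : ℕ} (hk : 2 ≤ k) (ha : 1 ≤ a) (han : a + k ≤ n)
    {X : Matrix (Fin k) (Fin (n - a + 1)) ℂ} (hX : NormalFrom X 1)
    {Y : Matrix (Fin k) (Fin (a + k - 1)) ℂ} (hY : NormalFrom Y 1) :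
    rightMatrix (glue X Y : Matrix (Fin k) (Fin n) ℂ) a = glueMatrix X Y a * Y := by
  have hl := leftMatrix_glue (n := n) ha (by omega) X Y
  have hV : NormalFrom (glue X Y : Matrix (Fin k) (Fin n) ℂ) a := by
    rw [← normalFrom_leftMatrix _ ha han, hl]
    exact hX
  refine ext_col fun j h1 h2 => ?_
  rw [col_mul]
  by_cases hj : j < a
  · rw [col_rightMatrix_of_le hk _ h1 hj.le, col_glue_of_lt _ _ h1 hj (by omega),
      glueMatrix_mulVec_col]
  · obtain ⟨i, rfl⟩ : ∃ i, j = a + i := ⟨j - a, by omega⟩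
    rw [col_rightMatrix_add hk ha han hV (by omega), ← uVec_leftMatrix _ ha han (by omega), hl,
      glueMatrix_mulVec_col_add X Y a (hY.1 a ha (by omega)) (by omega)]

/-! ### Equivariance under `SL_k` and the maps on the cones -/

theorem leftMatrix_mul {k n : ℕ} (A : Matrix (Fin k) (Fin k) ℂ) (V : Matrix (Fin k) (Fin n) ℂ)
    (a : ℕ) : leftMatrix (A * V) a = A * leftMatrix V a := by
  ext r j
  simp only [leftMatrix, Matrix.of_apply, col_mul]
  rfl

theorem rightMatrix_mul {k n : ℕ} (A : Matrix (Fin k) (Fin k) ℂ) (hA : A.det = 1)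
    (V : Matrix (Fin k) (Fin n) ℂ) (a : ℕ) : rightMatrix (A * V) a = A * rightMatrix V a := by
  ext r j
  simp only [rightMatrix, Matrix.of_apply, col_mul, uVec_mul A hA, minor_mul, hA, one_mul,
    Matrix.mul_apply]
  split_ifs
  · rfl
  · rfl
  · rw [Matrix.mulVec, dotProduct, Finset.sum_div]
    exact Finset.sum_congr rfl fun s _ => mul_div_assoc _ _ _

/-- Only minors of `Y` enter `glue`, so it is invariant under `SL_k` acting on `Y` and equivariant
in `X`; the two representatives may change independently. -/
theorem glue_mul {k n a : ℕ} (A B : Matrix (Fin k) (Fin k) ℂ) (hA : A.det = 1) (hB : B.det = 1)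
    (X : Matrix (Fin k) (Fin (n - a + 1)) ℂ) (Y : Matrix (Fin k) (Fin (a + k - 1)) ℂ) :
    (glue (A * X) (B * Y) : Matrix (Fin k) (Fin n) ℂ) = A * glue X Y := by
  ext r j
  simp only [glue, Matrix.of_apply, Matrix.mul_apply, col_mul, uVec_mul A hA, minor_mul, hB,
    one_mul]
  split_ifs
  · have h := congrFun (Matrix.mulVec_sum A Finset.univ fun i : Fin k =>
      minor Y (Function.update (consec a) i (j + 1)) • uVec X 1 i) r
    simp only [Matrix.mulVec_smul] at h
    exact h.symm
  · rfl

/-- The first component of the map on the cone. -/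
noncomputable def coneLeft {k n : ℕ} (a : ℕ) : Cone k n → Cone k (n - a + 1) :=
  Quotient.map (fun V => leftMatrix V a) (by
    rintro V W ⟨A, rfl⟩
    exact ⟨A, leftMatrix_mul A.1 V a⟩)

/-- The second component of the map on the cone. -/
noncomputable def coneRight {k n : ℕ} (a : ℕ) : Cone k n → Cone k (a + k - 1) :=
  Quotient.map (fun V => rightMatrix V a) (by
    rintro V W ⟨A, rfl⟩
    exact ⟨A, rightMatrix_mul A.1 A.2 V a⟩)

/-- The inverse map on the cones. -/
noncomputable def coneGlue {k n a : ℕ} : Cone k (n - a + 1) → Cone k (a + k - 1) → Cone k n :=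
  Quotient.map₂ (fun X Y => glue X Y) (by
    rintro X X' ⟨A, rfl⟩ Y Y' ⟨B, rfl⟩
    exact ⟨A, glue_mul A.1 B.1 A.2 B.2 X Y⟩)

theorem coneLeft_mem {k n a : ℕ} (ha : 1 ≤ a) (han : a + k ≤ n) {x : Cone k n}
    (hx : x ∈ normU k n a) : coneLeft a x ∈ normPositroid k (n - a + 1) := by
  obtain ⟨V, rfl⟩ := Quotient.exists_rep x
  have hV := ((mk_mem_normU (by omega) ha).1 hx).2
  exact (mk_mem_normPositroid (le_left_width han)).2 ((normalFrom_leftMatrix V ha han).2 hV)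

theorem coneRight_mem {k n a : ℕ} (hk : 2 ≤ k) (ha : 1 ≤ a) (han : a + k ≤ n) {x : Cone k n}
    (hx : x ∈ normU k n a) : coneRight a x ∈ normPositroid k (a + k - 1) := by
  obtain ⟨V, rfl⟩ := Quotient.exists_rep x
  have hV := (mk_mem_normU (by omega) ha).1 hx
  exact (mk_mem_normPositroid (le_right_width ha)).2
    ((normalFrom_rightMatrix hk ha han hV.2).2 hV.1)

theorem coneGlue_mem {k n a : ℕ} (hk : 2 ≤ k) (ha : 1 ≤ a) (han : a + k ≤ n)
    {x : Cone k (n - a + 1)} (hx : x ∈ normPositroid k (n - a + 1))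
    {y : Cone k (a + k - 1)} (hy : y ∈ normPositroid k (a + k - 1)) :
    (coneGlue x y : Cone k n) ∈ normU k n a := by
  obtain ⟨X, rfl⟩ := Quotient.exists_rep x
  obtain ⟨Y, rfl⟩ := Quotient.exists_rep y
  have hX := (mk_mem_normPositroid (le_left_width han)).1 hx
  have hY := (mk_mem_normPositroid (le_right_width ha)).1 hy
  have hV : NormalFrom (glue X Y : Matrix (Fin k) (Fin n) ℂ) a := by
    rw [← normalFrom_leftMatrix _ ha han, leftMatrix_glue ha (by omega)]
    exact hX
  refine (mk_mem_normU (V := glue X Y) (by omega) ha).2 ⟨?_, hV⟩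
  have hdet := det_glueMatrix hk (by omega) hX Y a (hY.1 a ha (by omega))
  -- The right part of the glued matrix is `glueMatrix * Y`, which has the same minors as `Y`.
  rw [← normalFrom_rightMatrix hk ha han hV, rightMatrix_glue hk ha han hX hY]
  simpa only [NormalFrom, minor_mul, hdet, one_mul] using hY

/-- The bijection underlying the isomorphism. -/
noncomputable def splitEquiv {k n a : ℕ} (hk : 2 ≤ k) (ha : 1 ≤ a) (han : a + k ≤ n) :
    normU k n a ≃ normPositroid k (n - a + 1) × normPositroid k (a + k - 1) where
  toFun x := (⟨coneLeft a x.1, coneLeft_mem ha han x.2⟩,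
    ⟨coneRight a x.1, coneRight_mem hk ha han x.2⟩)
  invFun z := ⟨coneGlue z.1.1 z.2.1, coneGlue_mem hk ha han z.1.2 z.2.2⟩
  left_inv := by
    rintro ⟨x, hx⟩
    obtain ⟨V, rfl⟩ := Quotient.exists_rep x
    have hV := ((mk_mem_normU (by omega) ha).1 hx).2
    exact Subtype.ext (congrArg Cone.mk (glue_leftMatrix_rightMatrix hk ha han hV))
  right_inv := by
    rintro ⟨⟨x, hx⟩, ⟨y, hy⟩⟩
    obtain ⟨X, rfl⟩ := Quotient.exists_rep x
    obtain ⟨Y, rfl⟩ := Quotient.exists_rep y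
    have hX := (mk_mem_normPositroid (le_left_width han)).1 hx
    have hY := (mk_mem_normPositroid (le_right_width ha)).1 hy
    refine Prod.ext (Subtype.ext ?_) (Subtype.ext ?_)
    · exact congrArg Cone.mk (leftMatrix_glue ha (by omega) X Y)
    · refine (congrArg Cone.mk (rightMatrix_glue hk ha han hX hY)).trans ?_
      refine (Quotient.sound ?_).symm
      exact ⟨⟨_, det_glueMatrix hk (by omega) hX Y a (hY.1 a ha (by omega))⟩, rfl⟩

/-! ### Regularity -/

theorem polyEval_mem_reg {X Y : Type} [Coordinates X] [Coordinates Y] (φ : X → Y)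
    (h : ∀ j, (fun x => Coordinates.coord j (φ x)) ∈ Reg X)
    (p : MvPolynomial (Coordinates.index Y) ℂ) : (fun x => polyEval p (φ x)) ∈ Reg X := by
  have h1 : (fun x => polyEval p (φ x)) =
      (MvPolynomial.aeval (fun j => (⟨_, h j⟩ : Reg X)) p : Reg X).1 := by
    funext x
    rw [reg_aeval]
    rfl
  rw [h1]
  exact Subtype.property _

/-- A map whose coordinates are regular pulls regular functions back to regular functions. -/
theorem comp_mem_reg_of_coord {X Y : Type} [Coordinates X] [Coordinates Y] (φ : X → Y)
    (h : ∀ j, (fun x => Coordinates.coord j (φ x)) ∈ Reg X) {g : Y → ℂ} (hg : g ∈ Reg Y) :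
    g ∘ φ ∈ Reg X := by
  intro x
  obtain ⟨p, q, hq, hpq⟩ := hg (φ x)
  obtain ⟨p₁, p₂, hp, hp'⟩ := polyEval_mem_reg φ h p x
  obtain ⟨q₁, q₂, hq', hq''⟩ := polyEval_mem_reg φ h q x
  have hmul : ∀ (p q : MvPolynomial (Coordinates.index X) ℂ) (y : X),
      polyEval (p * q) y = polyEval p y * polyEval q y := fun p q y => by simp [polyEval]
  have hq1 : polyEval q₁ x ≠ 0 := by
    intro h0
    apply hq
    have := hq'' x hq'
    simp only at this
    rw [this, h0, zero_div]
  -- The quotient `(p₁/p₂) / (q₁/q₂)`, expanded by `q₂` so that a nonzero denominator forces `q₂` to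
  -- be nonzero as well.
  refine ⟨p₁ * (q₂ * q₂), p₂ * (q₁ * q₂), ?_, fun y hy => ?_⟩
  · simp only [hmul]
    exact mul_ne_zero hp (mul_ne_zero hq1 hq')
  · simp only [hmul, mul_ne_zero_iff] at hy ⊢
    have h1 := hp' y hy.1
    have h2 := hq'' y hy.2.2
    simp only at h1 h2
    have h3 : polyEval q (φ y) ≠ 0 := by
      rw [h2]
      exact div_ne_zero hy.2.1 hy.2.2
    rw [Function.comp_apply, hpq _ h3, h1, h2]
    obtain ⟨a1, a2, a3⟩ := hy
    field_simp

theorem div_mem_reg {X : Type} [Coordinates X] {f g : X → ℂ} (hf : f ∈ Reg X) (hg : g ∈ Reg X)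
    (h0 : ∀ x, g x ≠ 0) : (fun x => f x / g x) ∈ Reg X := by
  obtain ⟨i, hi⟩ := isUnit_iff_exists_inv.1 (isUnit_reg ⟨g, hg⟩ h0)
  have h1 : (fun x => f x / g x) = f * i.1 := by
    funext x
    have h2 : g x * i.1 x = 1 := congrFun (congrArg Subtype.val hi) x
    rw [Pi.mul_apply, div_eq_iff (h0 x), mul_assoc, mul_comm (i.1 x), h2, mul_one]
  rw [h1]
  exact (Reg X).mul_mem hf i.2

/-- Families of vectors that are combinations of the columns of a family of matrices with regular
coefficients. -/
def RegVec {X : Type} [Coordinates X] {k m : ℕ} (M : X → Matrix (Fin k) (Fin m) ℂ)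
    (w : X → Fin k → ℂ) : Prop :=
  ∃ f : Fin m → Reg X, ∀ x, w x = (M x).mulVec fun j => (f j).1 x

section RegVec

variable {X : Type} [Coordinates X] {k m : ℕ} {M : X → Matrix (Fin k) (Fin m) ℂ}

theorem RegVec.col (hm : 0 < m) (j : ℕ) : RegVec M (fun x => OpenPositroid.col (M x) j) := by
  refine ⟨fun i => if i = ⟨(j + m - 1) % m, Nat.mod_lt _ hm⟩ then 1 else 0, fun x => ?_⟩
  funext r
  simp only [OpenPositroid.col, dif_pos hm, Matrix.mulVec, dotProduct]
  rw [Finset.sum_eq_single ⟨(j + m - 1) % m, Nat.mod_lt _ hm⟩]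
  · rw [if_pos rfl]
    exact (mul_one _).symm
  · intro i _ hi
    rw [if_neg hi]
    exact mul_zero _
  · intro h; exact absurd (Finset.mem_univ _) h

theorem RegVec.smul {f : X → ℂ} (hf : f ∈ Reg X) {w : X → Fin k → ℂ} (hw : RegVec M w) :
    RegVec M (fun x => f x • w x) := by
  obtain ⟨g, hg⟩ := hw
  refine ⟨fun j => ⟨f, hf⟩ * g j, fun x => ?_⟩
  simp only [hg]
  rw [← Matrix.mulVec_smul]
  rfl

theorem RegVec.sub {w w' : X → Fin k → ℂ} (hw : RegVec M w) (hw' : RegVec M w') :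
    RegVec M (fun x => w x - w' x) := by
  obtain ⟨g, hg⟩ := hw
  obtain ⟨g', hg'⟩ := hw'
  refine ⟨fun j => g j - g' j, fun x => ?_⟩
  simp only [hg, hg']
  rw [← Matrix.mulVec_sub]
  rfl

theorem RegVec.sum {ι : Type} (A : Finset ι) {w : ι → X → Fin k → ℂ}
    (hw : ∀ i ∈ A, RegVec M (w i)) : RegVec M (fun x => ∑ i ∈ A, w i x) := by
  choose! g hg using hw
  refine ⟨fun j => ∑ i ∈ A, g i j, fun x => ?_⟩
  show ∑ i ∈ A, w i x = _
  rw [Finset.sum_congr rfl fun i hi => hg i hi x, ← Matrix.mulVec_sum]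
  congr 1
  funext j
  rw [Finset.sum_apply]
  have h := map_sum ((Pi.evalAlgHom ℂ (fun _ : X => ℂ) x).comp (Reg X).val)
    (fun i => g i j) A
  exact h.symm

/-- The determinant of a matrix product as a sum over choices of columns of the first factor. -/
theorem det_mul_eq_sum (V : Matrix (Fin k) (Fin m) ℂ) (F : Matrix (Fin m) (Fin k) ℂ) :
    (V * F).det = ∑ p : Fin k → Fin m, (∏ s, F (p s) s) * (Matrix.of fun r s => V r (p s)).det := by
  rw [← Matrix.det_transpose]
  have h := (Matrix.detRowAlternating (R := ℂ) (n := Fin k)).toMultilinearMap.map_sum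
    (fun (s : Fin k) (j : Fin m) => F j s • fun r => V r j)
  have h2 : (V * F).transpose = fun s => ∑ j, F j s • fun r => V r j := by
    ext s r
    simp [Matrix.mul_apply, Finset.sum_apply, mul_comm]
  rw [h2]
  refine h.trans (Finset.sum_congr rfl fun p _ => ?_)
  rw [MultilinearMap.map_smul_univ, smul_eq_mul]
  congr 1
  rw [← Matrix.det_transpose]
  rfl

/-- If the maximal minors of a family of matrices are regular, then so are the determinants of
regular combinations of its columns. -/
theorem RegVec.det_mem (hM : ∀ J, (fun x => minor (M x) J) ∈ Reg X) {w : Fin k → X → Fin k → ℂ}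
    (hw : ∀ s, RegVec M (w s)) : (fun x => (Matrix.of fun r s => w s x r).det) ∈ Reg X := by
  choose g hg using hw
  have h1 : (fun x => (Matrix.of fun r s => w s x r).det) =
      -- The shift by one is due to column labels being counted from `1`.
      ∑ p : Fin k → Fin m, (∏ s, (g s (p s)).1) * fun x => minor (M x) fun s => p s + 1 := by
    funext x
    have h2 : (Matrix.of fun r s => w s x r) = M x * Matrix.of fun j s => (g s j).1 x := by
      ext r s
      simp only [Matrix.of_apply, hg]
      rfl
    rw [h2, det_mul_eq_sum, Finset.sum_apply]
    refine Finset.sum_congr rfl fun p _ => ?_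
    rw [Pi.mul_apply, Finset.prod_apply]
    congr 1
    unfold minor
    congr 1
    ext r s
    simp only [Matrix.of_apply]
    rw [col_eq _ (by omega) (by have := (p s).2; omega)]
    simp
  rw [h1]
  exact (Reg X).sum_mem fun p _ => (Reg X).mul_mem
    ((Reg X).prod_mem fun s _ => (g s (p s)).2) (hM _)

theorem RegVec.uVec (hm : 0 < m) (hM : ∀ J, (fun x => minor (M x) J) ∈ Reg X) (a i : ℕ)
    (h0 : ∀ x, minor (M x) (rectIdx m a i) ≠ 0) : RegVec M (fun x => uVec (M x) a i) := by
  refine (RegVec.col hm (a + i)).sub (RegVec.sum _ fun s _ => ?_)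
  split_ifs
  · exact (RegVec.col hm (a + s)).smul (div_mem_reg (hM _) (hM _) h0)
  · refine ⟨0, fun x => ?_⟩
    exact (Matrix.mulVec_zero _).symm

end RegVec

/-- A matrix representing a point of the cone. -/
noncomputable def Cone.rep {k n : ℕ} (x : Cone k n) : Matrix (Fin k) (Fin n) ℂ := Quotient.out x

theorem Cone.mk_rep {k n : ℕ} (x : Cone k n) : Cone.mk x.rep = x := Quotient.out_eq x

theorem minor_rep {k n : ℕ} (x : Cone k n) (J : Fin k → ℕ) : minor x.rep J = plucker J x := by
  conv_rhs => rw [← x.mk_rep]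
  rfl

theorem plucker_coneLeft_mem_reg {k n a : ℕ} (J : Fin k → ℕ) :
    (fun x : normU k n a => plucker J (coneLeft a x.1)) ∈ Reg (normU k n a) := by
  have h1 : (fun x : normU k n a => plucker J (coneLeft a x.1)) = fun x : normU k n a =>
      plucker (fun s => a + (J s + (n - a + 1) - 1) % (n - a + 1)) x.1 := by
    funext x
    rw [← x.1.mk_rep]
    show minor (leftMatrix _ a) J = minor _ _
    rfl
  rw [h1]
  exact coord_mem_reg (X := normU k n a) _

/-- Pluecker coordinates allow arbitrary labels; periodicity reduces them to the range where the
columns of the constructed matrices have been described. -/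
theorem exists_label {k n : ℕ} (hn : 0 < n) (j : ℕ) : ∃ i, 1 ≤ i ∧ i ≤ n ∧
    ∀ V : Matrix (Fin k) (Fin n) ℂ, col V j = col V i := by
  have hlt := Nat.mod_lt (j + n - 1) hn
  refine ⟨(j + n - 1) % n + 1, by omega, hlt, fun V => ?_⟩
  rw [col_eq _ (by omega) hlt]
  funext r
  simp only [col]
  rw [dif_pos hn]
  rfl

theorem plucker_coneRight_mem_reg {k n a : ℕ} (hk : 2 ≤ k) (ha : 1 ≤ a) (han : a + k ≤ n)
    (J : Fin k → ℕ) :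
    (fun x : normU k n a => plucker J (coneRight a x.1)) ∈ Reg (normU k n a) := by
  -- The representatives are chosen pointwise, with no regularity: `RegVec.det_mem` needs only the
  -- minors and the coefficients to be regular.
  let M : normU k n a → Matrix (Fin k) (Fin n) ℂ := fun x => x.1.rep
  have hM : ∀ J, (fun x => minor (M x) J) ∈ Reg (normU k n a) := by
    intro J
    simp only [M, minor_rep]
    exact coord_mem_reg (X := normU k n a) J
  have hN : ∀ x, NormalFrom (M x) a := fun x =>
    ((mk_mem_normU (by omega) ha).1 (by rw [x.1.mk_rep]; exact x.2)).2
  have h1 : (fun x : normU k n a => plucker J (coneRight a x.1)) = fun x : normU k n a =>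
      minor (rightMatrix (M x) a) J := by
    funext x
    conv_lhs => rw [← x.1.mk_rep]
    rfl
  rw [h1]
  refine RegVec.det_mem hM (w := fun s x => col (rightMatrix (M x) a) (J s)) fun s => ?_
  obtain ⟨j, hj1, hj2, hj⟩ := exists_label (k := k) (show 0 < a + k - 1 by omega) (J s)
  simp only [hj]
  by_cases hja : j ≤ a
  · simp only [col_rightMatrix_of_le hk _ hj1 hja]
    exact RegVec.col (by omega) j
  · obtain ⟨i, rfl⟩ : ∃ i, j = a + i := ⟨j - a, by omega⟩
    simp only [fun x => col_rightMatrix_add hk ha han (hN x) (show i < k by omega)]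
    exact RegVec.uVec (by omega) hM a i fun x => (hN x).minor_ne_zero han (by omega)

theorem plucker_coneGlue_mem_reg {k n a : ℕ} (ha : 1 ≤ a) (han : a + k ≤ n)
    (J : Fin k → ℕ) :
    (fun z : normPositroid k (n - a + 1) × normPositroid k (a + k - 1) =>
      plucker J (coneGlue z.1.1 z.2.1 : Cone k n)) ∈
      Reg (normPositroid k (n - a + 1) × normPositroid k (a + k - 1)) := by
  let Z : Type := normPositroid k (n - a + 1) × normPositroid k (a + k - 1)
  let M : Z → Matrix (Fin k) (Fin (n - a + 1)) ℂ := fun z => z.1.1.rep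
  have hM : ∀ J, (fun x => minor (M x) J) ∈ Reg Z := by
    intro J
    simp only [M, minor_rep]
    exact coord_mem_reg (X := Z) (Sum.inl J)
  have hY : ∀ J, (fun z : Z => minor z.2.1.rep J) ∈ Reg Z := by
    intro J
    simp only [minor_rep]
    exact coord_mem_reg (X := Z) (Sum.inr J)
  have hN : ∀ x, NormalFrom (M x) 1 := fun x =>
    (mk_mem_normPositroid (le_left_width han)).1 (by rw [x.1.1.mk_rep]; exact x.1.2)
  have h1 : (fun z : Z => plucker J (coneGlue z.1.1 z.2.1 : Cone k n)) = fun z : Z =>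
      minor (glue (M z) z.2.1.rep : Matrix (Fin k) (Fin n) ℂ) J := by
    funext x
    conv_lhs => rw [← x.1.1.mk_rep, ← x.2.1.mk_rep]
    rfl
  refine h1 ▸ RegVec.det_mem hM
    (w := fun s x => col (glue (M x) x.2.1.rep : Matrix (Fin k) (Fin n) ℂ) (J s)) fun s => ?_
  obtain ⟨j, hj1, hj2, hj⟩ := exists_label (k := k) (show 0 < n by omega) (J s)
  simp only [hj]
  by_cases hja : j < a
  · simp only [fun x : Z => col_glue_of_lt (M x) x.2.1.rep hj1 hja (by omega : a ≤ n)]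
    -- The first columns combine the `u_i` of the left factor with coefficients that are minors of
    -- the right factor.
    refine RegVec.sum _ fun i _ => RegVec.smul (hY _) ?_
    exact RegVec.uVec (by omega) hM 1 i fun x => (hN x).minor_ne_zero (by omega) i.2.le
  · simp only [fun x : Z => col_glue_of_ge (M x) x.2.1.rep ha (not_lt.1 hja) hj2]
    exact RegVec.col (by omega) _

/-- The isomorphism `V ↦ (V₁, V̄₂)`. -/
noncomputable def splitIso {k n a : ℕ} (hk : 2 ≤ k) (ha : 1 ≤ a) (han : a + k ≤ n) :
    VarIso (normU k n a) (normPositroid k (n - a + 1) × normPositroid k (a + k - 1)) where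
  toEquiv := splitEquiv hk ha han
  regular_toFun g hg := by
    refine comp_mem_reg_of_coord _ ?_ hg
    rintro (J | J)
    · exact plucker_coneLeft_mem_reg J
    · exact plucker_coneRight_mem_reg hk ha han J
  regular_invFun f hf := by
    refine comp_mem_reg_of_coord _ ?_ hf
    intro J
    exact plucker_coneGlue_mem_reg ha han J

/-! ### Exchange ratios of the rectangles quiver -/

/-- The exchange matrix of the rectangles quiver on the whole grid, in the rows without frozen
variables. -/
def rectWeight (p q p' q' : ℕ) : ℤ :=
  (if p' + 1 = p ∧ q' = q then 1 else 0) + (if p' = p ∧ q' = q + 1 then 1 else 0) +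
    (if p' = p + 1 ∧ q' + 1 = q then 1 else 0) - (if p' = p + 1 ∧ q' = q then 1 else 0) -
    (if p' = p ∧ q' + 1 = q then 1 else 0) - (if p' + 1 = p ∧ q' = q + 1 then 1 else 0)

theorem ite_or_eq_add {P Q : Prop} [Decidable P] [Decidable Q] (h : ¬(P ∧ Q)) :
    (if P ∨ Q then (1 : ℤ) else 0) = (if P then 1 else 0) + if Q then 1 else 0 := by
  by_cases hP : P <;> by_cases hQ : Q <;> simp_all

/-- Off the first row no arrow at `x` is suppressed, so its exchange row is the restriction of a
translation-invariant pattern on the whole grid. -/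
theorem rectExch_eq_rectWeight {m l : ℕ} (x y : Fin m × Fin l) (hx : (x.1 : ℕ) ≠ 0) :
    rectExch x y = rectWeight x.1 x.2 y.1 y.2 := by
  have h1 : (if RectArrow x y then (1 : ℤ) else 0) =
      (if (y.1 : ℕ) + 1 = x.1 ∧ (y.2 : ℕ) = x.2 then 1 else 0) +
      ((if (y.1 : ℕ) = x.1 ∧ (y.2 : ℕ) = x.2 + 1 then 1 else 0) +
      if (y.1 : ℕ) = x.1 + 1 ∧ (y.2 : ℕ) + 1 = x.2 then 1 else 0) := by
    rw [← ite_or_eq_add (by omega), ← ite_or_eq_add (by omega)]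
    exact if_congr (and_iff_right fun h => hx h.1) rfl rfl
  have h2 : (if RectArrow y x then (1 : ℤ) else 0) =
      (if (y.1 : ℕ) = x.1 + 1 ∧ (y.2 : ℕ) = x.2 then 1 else 0) +
      ((if (y.1 : ℕ) = x.1 ∧ (y.2 : ℕ) + 1 = x.2 then 1 else 0) +
      if (y.1 : ℕ) + 1 = x.1 ∧ (y.2 : ℕ) = x.2 + 1 then 1 else 0) := by
    rw [← ite_or_eq_add (by omega), ← ite_or_eq_add (by omega)]
    refine if_congr ((and_iff_right fun h => hx h.2).trans ?_) rfl rfl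
    omega
  rw [rectExch, h1, h2, rectWeight]
  ring

theorem rectWeight_add (p q p' q' c : ℕ) :
    rectWeight (p + c) q (c + p') q' = rectWeight p q p' q' := by
  simp only [rectWeight, show c + p' + 1 = p + c ↔ p' + 1 = p by omega,
    show c + p' = p + c ↔ p' = p by omega, show c + p' = p + c + 1 ↔ p' = p + 1 by omega]

theorem rectWeight_eq_zero {p q p' q' : ℕ} (h : p' + 1 < p ∨ p + 1 < p') :
    rectWeight p q p' q' = 0 := by
  unfold rectWeight
  rw [if_neg (by omega), if_neg (by omega), if_neg (by omega), if_neg (by omega),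
    if_neg (by omega), if_neg (by omega)]
  norm_num

/-- For each of `q' = q-1`, `q`, `q+1` the pattern has one entry `+1` and one entry `-1`, in
different rows. The bounds on `p` keep rows `p-1`, `p`, `p+1` inside the range. -/
theorem sum_rectWeight {p q q' m : ℕ} (hp : 1 ≤ p) (hpm : p + 1 < m) :
    ∑ p' ∈ Finset.range m, rectWeight p q p' q' = 0 := by
  obtain ⟨p, rfl⟩ : ∃ r, p = r + 1 := ⟨p - 1, by omega⟩
  have h : ∀ (c : ℕ) (P : Prop) [Decidable P], c < m →
      ∑ p' ∈ Finset.range m, (if p' = c ∧ P then (1 : ℤ) else 0) = if P then 1 else 0 := by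
    intro c P _ hc
    rw [Finset.sum_eq_single_of_mem c (Finset.mem_range.2 hc)]
    · simp
    · intro b _ hb
      simp [hb]
  simp only [rectWeight, Finset.sum_add_distrib, Finset.sum_sub_distrib, Nat.add_right_cancel_iff]
  rw [h p _ (by omega), h (p + 1) _ (by omega), h (p + 1 + 1) _ (by omega),
    h (p + 1 + 1) _ (by omega), h (p + 1) _ (by omega), h p _ (by omega)]
  ring

section Ratio

variable {K : Type} [Field K] {A : ℕ → ℕ → K}

/-- This matches the left factor: the exponents vanish on the rows below `c`, since a mutable row `p
+ c` with `p ≥ 1` has neighbours only in rows at least `c`. -/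
theorem prod_rectWeight_shift (c m l p q : ℕ) (hp : 1 ≤ p) :
    ∏ p' ∈ Finset.range (c + m), ∏ q' ∈ Finset.range l, A p' q' ^ rectWeight (p + c) q p' q' =
      ∏ p' ∈ Finset.range m, ∏ q' ∈ Finset.range l, A (p' + c) q' ^ rectWeight p q p' q' := by
  rw [Finset.prod_range_add, Finset.prod_eq_one, one_mul]
  · refine Finset.prod_congr rfl fun p' _ => Finset.prod_congr rfl fun q' _ => ?_
    rw [rectWeight_add, add_comm c p']
  · intro p' hp'
    have := Finset.mem_range.1 hp'
    refine Finset.prod_eq_one fun q' _ => ?_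
    rw [rectWeight_eq_zero (by omega), zpow_zero]

/-- This matches the right factor, with `c = a-1` the row of the `Δ_{I(a,i)}`. Dividing each column
by its entry in row `c` changes nothing because the exponents of the column sum to zero; row `c`
itself then becomes `1` and drops out, and rows beyond it have exponent zero. -/
theorem prod_rectWeight_div (c m l p q : ℕ) (hp : 1 ≤ p) (hpc : p < c)
    (hA : ∀ q' < l, A c q' ≠ 0) :
    ∏ p' ∈ Finset.range (c + 1 + m), ∏ q' ∈ Finset.range l, A p' q' ^ rectWeight p q p' q' =
      ∏ p' ∈ Finset.range c, ∏ q' ∈ Finset.range l,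
        (A p' q' / A c q') ^ rectWeight p q p' q' := by
  have h1 : ∏ p' ∈ Finset.range (c + 1), ∏ q' ∈ Finset.range l,
      A c q' ^ rectWeight p q p' q' = 1 := by
    rw [Finset.prod_comm]
    refine Finset.prod_eq_one fun q' hq' => ?_
    have h0 := hA q' (Finset.mem_range.1 hq')
    have h2 : ∀ s : Finset ℕ, ∏ p' ∈ s, A c q' ^ rectWeight p q p' q' =
        A c q' ^ ∑ p' ∈ s, rectWeight p q p' q' := by
      intro s
      induction s using Finset.induction_on with
      | empty => simp
      | insert x s hx ih => rw [Finset.prod_insert hx, Finset.sum_insert hx, ih, zpow_add₀ h0]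
    rw [h2, sum_rectWeight hp (by omega), zpow_zero]
  have h2 : ∏ q' ∈ Finset.range l, (A c q' / A c q') ^ rectWeight p q c q' = 1 := by
    refine Finset.prod_eq_one fun q' hq' => ?_
    rw [div_self (hA q' (Finset.mem_range.1 hq')), one_zpow]
  have h3 : ∏ p' ∈ Finset.range m, ∏ q' ∈ Finset.range l,
      A (c + 1 + p') q' ^ rectWeight p q (c + 1 + p') q' = 1 := by
    refine Finset.prod_eq_one fun x _ => Finset.prod_eq_one fun q' _ => ?_
    rw [rectWeight_eq_zero (by omega), zpow_zero]
  have h4 : ∏ p' ∈ Finset.range (c + 1), ∏ q' ∈ Finset.range l, A p' q' ^ rectWeight p q p' q' =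
      (∏ p' ∈ Finset.range (c + 1), ∏ q' ∈ Finset.range l,
        (A p' q' / A c q') ^ rectWeight p q p' q') *
      ∏ p' ∈ Finset.range (c + 1), ∏ q' ∈ Finset.range l, A c q' ^ rectWeight p q p' q' := by
    simp only [← Finset.prod_mul_distrib]
    refine Finset.prod_congr rfl fun p' _ => Finset.prod_congr rfl fun q' hq' => ?_
    rw [← mul_zpow, div_mul_cancel₀ _ (hA q' (Finset.mem_range.1 hq'))]
  rw [Finset.prod_range_add, h3, mul_one, h4, h1, mul_one, Finset.prod_range_succ, h2, mul_one]

theorem prod_grid (m l : ℕ) (F : ℕ → ℕ → K) :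
    ∏ y : Fin m × Fin l, F y.1 y.2 = ∏ p ∈ Finset.range m, ∏ q ∈ Finset.range l, F p q := by
  rw [Fintype.prod_prod_type]
  rw [← Fin.prod_univ_eq_prod_range (fun p => ∏ q ∈ Finset.range l, F p q) m]
  refine Finset.prod_congr rfl fun p _ => ?_
  exact Fin.prod_univ_eq_prod_range (fun q => F p q) l

end Ratio

/-- Algebraic independence makes the cluster variables nonzero in the fraction field, so positive
and negative exponents combine into integer powers. -/
theorem Seed.exchangeRatio_eq {R ι : Type} [CommRing R] [Algebra ℂ R] [Fintype ι] [IsDomain R]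
    (S : Seed R ι) (i : ι) :
    S.exchangeRatio i = ∏ j, algebraMap R (FractionRing R) (S.var j) ^ S.exch i j := by
  unfold Seed.exchangeRatio
  rw [← Finset.prod_div_distrib]
  refine Finset.prod_congr rfl fun j _ => ?_
  have h0 : algebraMap R (FractionRing R) (S.var j) ≠ 0 :=
    (map_ne_zero_iff _ (IsFractionRing.injective R (FractionRing R))).2 (S.algInd.ne_zero j)
  rw [← zpow_natCast, ← zpow_natCast, ← zpow_sub₀ h0]
  congr 1
  omega

/-! ### The pullback of the product seed -/

/-- The matching of the vertices of the quivers of the two seeds. -/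
def splitIndex {k n a : ℕ} (ha : 1 ≤ a) (han : a + k ≤ n) :
    Fin (n - a + 1 - k) × Fin (k - 1) ⊕ Fin (a + k - 1 - k) × Fin (k - 1) ≃
      Fin (n - k) × Fin (k - 1) where
  toFun := Sum.elim (fun p => (⟨p.1 + (a - 1), by omega⟩, p.2)) fun p => (⟨p.1, by omega⟩, p.2)
  invFun p := if h : (p.1 : ℕ) < a - 1 then Sum.inr (⟨p.1, by omega⟩, p.2)
    else Sum.inl (⟨p.1 - (a - 1), by omega⟩, p.2)
  left_inv := by
    rintro (⟨p, q⟩ | ⟨p, q⟩)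
    · simp
    · have := p.2
      exact dif_pos (show (p : ℕ) < a - 1 by omega)
  right_inv := by
    rintro ⟨p, q⟩
    by_cases h : (p : ℕ) < a - 1
    · simp [h]
    · simp only [h, dite_false, Sum.elim_inl]
      congr 2
      omega

section Pullback

variable {k n a : ℕ} (hk : 2 ≤ k) (ha : 1 ≤ a) (han : a + k ≤ n)

/-- The seed of `U_a^1`. -/
noncomputable abbrev coneSeed : Seed (Reg (normU k n a)) (Fin (n - k) × Fin (k - 1)) :=
  frozenSeed (one_le_of_two_le hk) ha han

/-- The pullback of the product of the rectangles seeds. -/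
noncomputable def splitSeed : Seed (Reg (normU k n a))
    (Fin (n - a + 1 - k) × Fin (k - 1) ⊕ Fin (a + k - 1 - k) × Fin (k - 1)) :=
  ((normSeed (k := k) (n := n - a + 1) (one_le_of_two_le hk) (le_left_width han)).prod
    (normSeed (k := k) (n := a + k - 1) (one_le_of_two_le hk) (le_right_width ha))).map
      (splitIso hk ha han).pullback

theorem splitSeed_var_inl (p : Fin (n - a + 1 - k) × Fin (k - 1)) :
    (splitSeed hk ha han).var (Sum.inl p) =
      rectVar (normU k n a) (p.1 + (a - 1) + 1) (p.2 + 1) := by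
  apply Subtype.ext
  funext x
  obtain ⟨x, hx⟩ := x
  obtain ⟨V, rfl⟩ := Quotient.exists_rep x
  have h1 := p.1.2
  have h2 := p.2.2
  show minor (leftMatrix V a) (rectIdx (n - a + 1) (p.1 + 1) (p.2 + 1)) =
    minor V (rectIdx n (p.1 + (a - 1) + 1) (p.2 + 1))
  rw [minor_leftMatrix_rectIdx V ha han (by omega) (by omega)]
  congr 2; omega

theorem splitSeed_var_inr (p : Fin (a + k - 1 - k) × Fin (k - 1)) :
    (splitSeed hk ha han).var (Sum.inr p) * rectVar (normU k n a) a (p.2 + 1) =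
      rectVar (normU k n a) (p.1 + 1) (p.2 + 1) := by
  apply Subtype.ext
  funext x
  obtain ⟨x, hx⟩ := x
  obtain ⟨V, rfl⟩ := Quotient.exists_rep x
  have hV := ((mk_mem_normU (by omega) ha).1 hx).2
  have h1 := p.1.2
  have h2 := p.2.2
  show minor (rightMatrix V a) (rectIdx (a + k - 1) (p.1 + 1) (p.2 + 1)) *
    minor V (rectIdx n a (p.2 + 1)) = minor V (rectIdx n (p.1 + 1) (p.2 + 1))
  rw [minor_rightMatrix_rectIdx hk ha han hV (by omega) (by omega) (by omega),
    div_mul_cancel₀ _ (hV.minor_ne_zero han (by omega))]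

theorem splitIndex_mem_frozen
    (j : Fin (n - a + 1 - k) × Fin (k - 1) ⊕ Fin (a + k - 1 - k) × Fin (k - 1)) :
    j ∈ (splitSeed hk ha han).frozen ↔
      splitIndex ha han j ∈ (coneSeed hk ha han).frozen := by
  rcases j with ⟨p, q⟩ | ⟨p, q⟩
  · show (p : ℕ) + 1 = 1 ↔ (p : ℕ) + (a - 1) + 1 = 1 ∨ (p : ℕ) + (a - 1) + 1 = a
    omega
  · have := p.2
    show (p : ℕ) + 1 = 1 ↔ (p : ℕ) + 1 = 1 ∨ (p : ℕ) + 1 = a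
    omega

/-- The factor is `1` on the left and `Δ_{I(a,i)}` on the right. Membership in both frozen groups at
once is what yields the two inclusions of `frozenGroup_eq` without circularity. -/
theorem frozenSeed_var_eq
    (j : Fin (n - a + 1 - k) × Fin (k - 1) ⊕ Fin (a + k - 1 - k) × Fin (k - 1)) :
    ∃ m ∈ (coneSeed hk ha han).frozenGroup ⊓
        (splitSeed hk ha han).frozenGroup,
      (coneSeed hk ha han).var (splitIndex ha han j) =
        (m : Reg (normU k n a)) * (splitSeed hk ha han).var j := by
  rcases j with p | p
  · refine ⟨1, Subgroup.one_mem _, ?_⟩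
    rw [splitSeed_var_inl, Units.val_one, one_mul]
    rfl
  · have h1 := (coneSeed hk ha han).isUnit_frozen
      (⟨a - 1, by omega⟩, p.2) (Or.inr (by simp only; omega))
    have h2 : (coneSeed hk ha han).var
        (⟨a - 1, by omega⟩, p.2) = rectVar (normU k n a) a (p.2 + 1) := by
      show rectVar _ (a - 1 + 1) _ = _
      rw [Nat.sub_add_cancel ha]
    refine ⟨h1.unit, ⟨Subgroup.subset_closure ⟨(⟨a - 1, by omega⟩, p.2),
      Or.inr (by simp only; omega), rfl⟩,
      -- In the product seed `Δ_{I(a,i)}` is the frozen variable of the left factor with `b = 1`.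
      Subgroup.subset_closure ⟨Sum.inl (⟨0, by omega⟩, p.2), rfl, ?_⟩⟩, ?_⟩
    · rw [splitSeed_var_inl, IsUnit.unit_spec, h2]
      simp only
      congr 1; omega
    · rw [IsUnit.unit_spec, h2, mul_comm, splitSeed_var_inr]
      rfl

theorem frozenGroup_eq :
    (coneSeed hk ha han).frozenGroup =
      (splitSeed hk ha han).frozenGroup := by
  apply le_antisymm
  · refine (Subgroup.closure_le _).2 ?_
    rintro u ⟨j, hj, hu⟩
    obtain ⟨j, rfl⟩ := (splitIndex ha han).surjective j
    rw [← splitIndex_mem_frozen hk] at hj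
    obtain ⟨m, ⟨-, hm⟩, h⟩ := frozenSeed_var_eq hk ha han j
    have h1 := (splitSeed hk ha han).isUnit_frozen j hj
    have h2 : u = m * h1.unit := Units.ext (hu.trans h)
    rw [h2]
    exact Subgroup.mul_mem _ hm (Subgroup.subset_closure ⟨j, hj, rfl⟩)
  · refine (Subgroup.closure_le _).2 ?_
    rintro u ⟨j, hj, hu⟩
    obtain ⟨m, ⟨hm, -⟩, h⟩ := frozenSeed_var_eq hk ha han j
    rw [splitIndex_mem_frozen] at hj
    have h1 := (coneSeed hk ha han).isUnit_frozen _ hj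
    have h2 : u = m⁻¹ * h1.unit := by
      rw [eq_inv_mul_iff_mul_eq]
      exact Units.ext (by rw [Units.val_mul, hu, IsUnit.unit_spec, h])
    rw [h2]
    exact Subgroup.mul_mem _ (Subgroup.inv_mem _ hm) (Subgroup.subset_closure ⟨_, hj, rfl⟩)

theorem splitSeed_exchangeRatio [IsDomain (Reg (normU k n a))]
    (j : Fin (n - a + 1 - k) × Fin (k - 1) ⊕ Fin (a + k - 1 - k) × Fin (k - 1))
    (hj : j ∉ (splitSeed hk ha han).frozen) :
    (coneSeed hk ha han).exchangeRatio
      (splitIndex ha han j) = (splitSeed hk ha han).exchangeRatio j := by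
  let ψ := algebraMap (Reg (normU k n a)) (FractionRing (Reg (normU k n a)))
  let A : ℕ → ℕ → FractionRing (Reg (normU k n a)) := fun p q =>
    ψ (rectVar (normU k n a) (p + 1) (q + 1))
  have hleft : ∀ x : Fin (n - k) × Fin (k - 1), (x.1 : ℕ) ≠ 0 →
      (coneSeed hk ha han).exchangeRatio x =
      ∏ p' ∈ Finset.range (n - k), ∏ q' ∈ Finset.range (k - 1),
        A p' q' ^ rectWeight x.1 x.2 p' q' := by
    intro x hx
    rw [Seed.exchangeRatio_eq, ← prod_grid]
    refine Finset.prod_congr rfl fun y _ => ?_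
    rw [← rectExch_eq_rectWeight x y hx]
    rfl
  rw [Seed.exchangeRatio_eq (splitSeed hk ha han), Fintype.prod_sum_type]
  rcases j with x | x
  · have hx : (x.1 : ℕ) ≠ 0 := fun h => hj (by
      show (x.1 : ℕ) + 1 = 1
      omega)
    have h1 := x.1.2
    rw [hleft _ (by show (x.1 : ℕ) + (a - 1) ≠ 0; omega)]
    show ∏ p' ∈ Finset.range (n - k), ∏ q' ∈ Finset.range (k - 1),
        A p' q' ^ rectWeight (x.1 + (a - 1)) x.2 p' q' = _
    rw [show n - k = a - 1 + (n - a + 1 - k) by omega,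
      prod_rectWeight_shift _ _ _ _ _ (by omega), ← prod_grid]
    -- Variables of the other factor have exponent zero, as the quiver of a product is a disjoint
    -- union.
    rw [Finset.prod_eq_one (s := (Finset.univ : Finset (Fin (a + k - 1 - k) × Fin (k - 1)))),
      mul_one]
    · refine Finset.prod_congr rfl fun y _ => ?_
      rw [← rectExch_eq_rectWeight x y hx, splitSeed_var_inl]
      rfl
    · intro y _
      exact zpow_zero _
  · have hx : (x.1 : ℕ) ≠ 0 := fun h => hj (by
      show (x.1 : ℕ) + 1 = 1
      omega)
    have h1 := x.1.2
    rw [hleft _ hx]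
    show ∏ p' ∈ Finset.range (n - k), ∏ q' ∈ Finset.range (k - 1),
        A p' q' ^ rectWeight x.1 x.2 p' q' = _
    have hA : ∀ q' < k - 1, A (a - 1) q' ≠ 0 := by
      intro q' hq'
      refine (map_ne_zero_iff ψ (IsFractionRing.injective _ _)).2 ?_
      exact (coneSeed hk ha han).algInd.ne_zero
        (⟨a - 1, by omega⟩, ⟨q', hq'⟩)
    -- The rows split into the `a-1` rows of the right factor, the row of the `Δ_{I(a,i)}`, and the
    -- rest.
    rw [show n - k = a - 1 + 1 + (n - k - a) by omega,
      prod_rectWeight_div _ _ _ _ _ (by omega) (by omega) hA,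
      show Finset.range (a - 1) = Finset.range (a + k - 1 - k) by congr 1; omega, ← prod_grid]
    rw [Finset.prod_eq_one (s := (Finset.univ : Finset (Fin (n - a + 1 - k) × Fin (k - 1)))),
      one_mul]
    · refine Finset.prod_congr rfl fun y _ => ?_
      rw [← rectExch_eq_rectWeight x y hx]
      have h2 : A y.1 y.2 / A (a - 1) y.2 = ψ ((splitSeed hk ha han).var (Sum.inr y)) := by
        rw [div_eq_iff (hA _ y.2.2)]
        simp only [A]
        rw [← map_mul, Nat.sub_add_cancel ha, splitSeed_var_inr]
      rw [h2]
      rfl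
    · intro y _
      exact zpow_zero _

theorem quasiEquivalent_splitSeed [IsDomain (Reg (normU k n a))] :
    (coneSeed hk ha han).QuasiEquivalent
      (splitSeed hk ha han) := by
  let e : (splitSeed hk ha han).Mutable ≃
      (coneSeed hk ha han).Mutable :=
    (splitIndex ha han).subtypeEquiv fun j => not_congr (splitIndex_mem_frozen hk ha han j)
  refine ⟨frozenGroup_eq hk ha han, e.symm, fun i => ?_⟩
  obtain ⟨j, rfl⟩ := e.surjective i
  rw [e.symm_apply_apply]
  obtain ⟨m, ⟨hm, -⟩, h⟩ := frozenSeed_var_eq hk ha han j.1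
  exact ⟨⟨m, hm, h⟩, splitSeed_exchangeRatio hk ha han j.1 j.2⟩

end Pullback

end OpenPositroid

theorem mainTheorem2 (k n a : ℕ) (hk : 2 ≤ k) (ha : 1 ≤ a) (han : a + k ≤ n) :
    ∃ Φ : VarIso (normU k n a) (normPositroid k (n - a + 1) × normPositroid k (a + k - 1)),
      (∀ (V : Matrix (Fin k) (Fin n) ℂ) (hV : Cone.mk V ∈ normU k n a),
        (Φ.toFun ⟨Cone.mk V, hV⟩).1.1 = Cone.mk (leftMatrix V a) ∧
        (Φ.toFun ⟨Cone.mk V, hV⟩).2.1 = Cone.mk (rightMatrix V a)) ∧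
      haveI : IsDomain (Reg (normU k n a)) := isDomain_reg_normU (by omega) ha han
      (frozenSeed (k := k) (n := n) (a := a) (by omega) ha han).QuasiEquivalent
        (((normSeed (k := k) (n := n - a + 1) (by omega) (by omega)).prod
          (normSeed (k := k) (n := a + k - 1) (by omega) (by omega))).map Φ.pullback) := by
  have : IsDomain (Reg (normU k n a)) := isDomain_reg_normU (one_le_of_two_le hk) ha han
  -- The maps on the cones are lifted from representatives, so their values on `Cone.mk V` hold by
  -- definition.
  exact ⟨splitIso hk ha han, fun V hV => ⟨rfl, rfl⟩, quasiEquivalent_splitSeed hk ha han⟩
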